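/- **Setting.** Let $M\ge 1$ be an integer, $r,t\in[0,1]$ with $r^2+t^2=1$ and $rt\neq 0$; $\mathbb T\subset\mathbb C$ is the unit circle, $dl$ its normalized Lebesgue measure, and second indices are taken modulo $2M$. For phases $p\in\mathbb T^{\mathbb Z\times\mathbb Z_{2M}}$ let $U(p)=D(p)\mathbb S$ on $l^2(\mathbb Z\times\mathbb Z_{2M})$ (Chalker–Coddington model on the cylinder), where $D(p)$ is diagonal with entries $p_{n,k}$ and $$\mathbb S e_{2j,2k}=t\,e_{2j+1,2k}+r\,e_{2j,2k+1},\qquad \mathbb S e_{2j+1,2k+1}=-r\,e_{2j+1,2k}+t\,e_{2j,2k+1},$$ $$\mathbb S e_{2j+2,2k+1}=t\,e_{2j+2,2k+2}+r\,e_{2j+1,2k+1},\qquad \mathbb S e_{2j+1,2k+2}=-r\,e_{2j+2,2k+2}+t\,e_{2j+1,2k+1}.$$ The phases are i.i.d. with law $dl$. For $L\in\mathbb N$ let $U^D=U^D_L(p)$ be the unitary matrix on $l^2(\{-2L,\dots,2L\}\times\mathbb Z_{2M})$ with $$U^De_{-2L,2k+1}=e_{-2L,2k+2},\qquad U^De_{2L,2k}=e_{2L,2k+1},$$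 and all other columns equal to those of $U(p)$ (reflecting boundary conditions). Let $\mu_L^{(M)}=\mu_L^{(M)}(p)$ be the normalized counting measure of the eigenvalues of $U^D$ (with multiplicity). For $z\ne0$ let $M_1(z)$ be the $2M\times 2M$ matrix with diagonal blocks $\frac1t\begin{pmatrix}z^{-1}&-r\\-r&z\end{pmatrix}$ on the coordinates $(2k,2k+1)$, and $M_2(z)$ the one with blocks $\frac1r\begin{pmatrix}z&-t\\t&-z^{-1}\end{pmatrix}$ on the coordinates $(2k+1,2k+2)$, $k\in\mathbb Z_M$. Put $$A_z(j)=D_l(j)\,M_2(z)\,D_m(j)\,M_1(z)\,D_r(j),\qquad j\in\mathbb Z,$$ with diagonal matrices $D_l(j)=\mathrm{diag}(p_{2j+2,0},1,p_{2j+2,2},1,\dots)$, $D_m(j)=\mathrm{diag}(p_{2j+1,0},\overline{p_{2j+1,1}},p_{2j+1,2},\overline{p_{2j+1,3}},\dots)$, $D_r(j)=\mathrm{diag}(1,\overline{p_{2j,1}},1,\overline{p_{2j,3}},\dots)$; this is the transfer matrix from column $2j$ to column $2j+2$ of solutions of $U(p)\psi=z\psi$. Let $P_{2L}(z)=A_z(L-1)A_z(L-2)\cdots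 A_z(-L)$, and let $\|\wedge^MP_{2L}(z)\|$ be the operator norm of its $M$-th exterior power on $\wedge^M\mathbb C^{2M}$, for which the vectors $e_{i_1}\wedge\dots\wedge e_{i_M}$ $(i_1<\dots<i_M)$ are orthonormal. **Lemma.** 0. For all $p$ and $L$, $\mu_L^{(M)}$ is a probability measure on $\mathbb T$, and $$\frac{1}{(4L+1)2M}\,\mathrm{tr}\,f(U^D)=\int_{\mathbb T}f(x)\,d\mu_L^{(M)}(x)\qquad(f\in C(\mathbb T)).$$ 1. For almost every $p$, $\mu_L^{(M)}\to dl$ vaguely as $L\to\infty$: $\int f\,d\mu_L^{(M)}\to\int f\,dl$ for all $f\in C(\mathbb T)$. Thus the density of states is flat. 2. There is a constant $c_M>0$ depending only on $M$ such that for all $r,t$ as above, all phases $p$, all integers $L\ge1$ and all $0\ne z\in\mathbb C\setminus\mathbb T$, $$\frac{1}{4LM}\log\bigl\|\wedge^MP_{2L}(z)\bigr\|\ \ge\ \frac12\log\frac1{rt}+\Bigl(2+\frac1{2L}\Bigr)\int_{\mathbb T}\log|z-x|\,d\mu_L^{(M)}(x)-\Bigl(1+\frac1{4L}\Bigr)\log|z|-\frac{c_M\,(1+|\log|z||)}{L}.$$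 -/

import Mathlib

open scoped Matrix.Norms.L2Operator

/-- The Borel structure on the unit circle `𝕋`. -/
noncomputable instance Circle.instMeasurableSpaceBorel : MeasurableSpace Circle := borel Circle

instance Circle.instBorelSpaceBorel : BorelSpace Circle := ⟨rfl⟩

namespace ChalkerCoddington

noncomputable section

/-! ### The random network operator on the cylinder `ℤ × ℤ_{2M}`

The discrete circle `ℤ_{2M}` is `Fin (2 * M)`, whose addition and subtraction are modulo `2M`
(so `k + 1`, `k - 1` are the cyclic neighbours); the parity of `k` is the parity of its
representative in `{0, …, 2M - 1}`. -/

/-- The sites of the cylinder `ℤ × ℤ_{2M}`. -/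
abbrev Site (M : ℕ) : Type := ℤ × Fin (2 * M)

/-- A realisation of the disorder: one phase in `𝕋` per site. -/
abbrev Phases (M : ℕ) : Type := Site M → Circle

/-- The normalised Lebesgue (Haar) measure `dl` on `𝕋`. -/
def dl : MeasureTheory.Measure Circle := MeasureTheory.Measure.haarMeasure ⊤

instance : MeasureTheory.IsProbabilityMeasure dl :=
  ⟨MeasureTheory.Measure.haarMeasure_self (K₀ := ⊤)⟩

/-- The law of the disorder: the phases are independent and uniformly distributed. -/
def phaseLaw (M : ℕ) : MeasureTheory.Measure (Phases M) :=
  MeasureTheory.Measure.infinitePi fun _ => dl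

/-- The image `𝕊 e_{n,k}` of a canonical basis vector under the network operator all of whose
phases are one. At the node met by the two incoming links the scattering matrix is
`[[t, -r], [r, t]]`:
* even nodes: incoming `(2j, 2k)`, `(2j+1, 2k+1)`, outgoing `(2j+1, 2k)`, `(2j, 2k+1)`;
* odd nodes: incoming `(2j+2, 2k+1)`, `(2j+1, 2k+2)`, outgoing `(2j+2, 2k+2)`, `(2j+1, 2k+1)`. -/
def freeStep {M : ℕ} [NeZero M] (r t : ℝ) (ν : Site M) : Site M → ℂ :=
  let n := ν.1
  let k := ν.2
  if Even n then
    if Even (k : ℕ) then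
      Pi.single (n + 1, k) (t : ℂ) + Pi.single (n, k + 1) (r : ℂ)
    else
      Pi.single (n, k + 1) (t : ℂ) + Pi.single (n - 1, k) (r : ℂ)
  else
    if Even (k : ℕ) then
      Pi.single (n + 1, k) (-(r : ℂ)) + Pi.single (n, k - 1) (t : ℂ)
    else
      Pi.single (n, k - 1) (-(r : ℂ)) + Pi.single (n - 1, k) (t : ℂ)

/-- The matrix elements `U(p)_{μ,ν}` of the network operator `U(p) = D(p) 𝕊` on
`l²(ℤ × ℤ_{2M})`, where `D(p)` is the diagonal operator with entries `p μ`. -/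
def networkEntry {M : ℕ} [NeZero M] (r t : ℝ) (p : Phases M) (μ ν : Site M) : ℂ :=
  (p μ : ℂ) * freeStep r t ν μ

/-! ### The truncation with reflecting boundary conditions and its density of states -/

/-- The sites of the finite cylinder `{-2L, …, 2L} × ℤ_{2M}`. -/
abbrev Box (L M : ℕ) : Type := Finset.Icc (-(2 * (L : ℤ))) (2 * (L : ℤ)) × Fin (2 * M)

/-- The site of the infinite cylinder underlying a site of the finite one. -/
def Box.toSite {L M : ℕ} (μ : Box L M) : Site M := (μ.1, μ.2)

/-- The restriction `U^D` of `U(p)` to the finite cylinder with reflecting boundary conditions: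
the links which are incoming to the walls at `±(2L+1)` are reflected,
`U^D e_{-2L,2k+1} = e_{-2L,2k+2}` and `U^D e_{2L,2k} = e_{2L,2k+1}`; all the other
matrix elements are those of `U(p)`. -/
def reflected {M : ℕ} [NeZero M] (r t : ℝ) (p : Phases M) (L : ℕ) :
    Matrix (Box L M) (Box L M) ℂ :=
  Matrix.of fun μ ν =>
    if (ν.toSite.1 = -(2 * (L : ℤ)) ∧ Odd (ν.2 : ℕ)) ∨
        (ν.toSite.1 = 2 * (L : ℤ) ∧ Even (ν.2 : ℕ)) then
      if μ = (ν.1, ν.2 + 1) then 1 else 0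
    else networkEntry r t p μ.toSite ν.toSite

/-- The finite-volume density of states `μ_L^{(M)}`: the normalised counting measure on `𝕋` of the
`(4L+1)2M` eigenvalues of the unitary matrix `U^D`, repeated according to multiplicity. (The
sum of point masses is a measure on `ℂ`; `comap` regards it as a measure on `𝕋 ⊆ ℂ`.) -/
def densityOfStates {M : ℕ} [NeZero M] (r t : ℝ) (p : Phases M) (L : ℕ) :
    MeasureTheory.Measure Circle :=
  ((((4 * L + 1) * (2 * M) : ℕ) : ENNReal)⁻¹) •
    (((reflected r t p L).charpoly.roots.map MeasureTheory.Measure.dirac).sum).comap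
      (fun x : Circle => (x : ℂ))

/-! ### Transfer matrices -/

/-- The block matrix `M₁(z)`, with `M` diagonal blocks `t⁻¹ [[z⁻¹, -r], [-r, z]]` in the
coordinates `(2k, 2k+1)`. -/
def transferEven {M : ℕ} [NeZero M] (r t : ℝ) (z : ℂ) :
    Matrix (Fin (2 * M)) (Fin (2 * M)) ℂ :=
  Matrix.of fun i j => (t : ℂ)⁻¹ *
    if Even (i : ℕ) then (if j = i then z⁻¹ else if j = i + 1 then -(r : ℂ) else 0)
    else (if j = i then z else if j = i - 1 then -(r : ℂ) else 0)

/-- The block matrix `M₂(z)`, with `M` blocks `r⁻¹ [[z, -t], [t, -z⁻¹]]` in the (cyclic)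
coordinates `(2k+1, 2k+2)`. -/
def transferOdd {M : ℕ} [NeZero M] (r t : ℝ) (z : ℂ) :
    Matrix (Fin (2 * M)) (Fin (2 * M)) ℂ :=
  Matrix.of fun i j => (r : ℂ)⁻¹ *
    if Even (i : ℕ) then (if j = i then -z⁻¹ else if j = i - 1 then (t : ℂ) else 0)
    else (if j = i then z else if j = i + 1 then -(t : ℂ) else 0)

/-- An element `(p₀, …, p_{2M-1}; p_{2M}, …, p_{4M-1})` of `𝕋^{4M}`: the phases entering one
generator of the cocycle. -/
abbrev CellPhases (M : ℕ) : Type := (Fin (2 * M) → Circle) × (Fin (2 * M) → Circle)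

/-- The generator `A_z = D(p_l) M₂(z) D(p_m) M₁(z) D(p_r)` with
`p_l = (p₀, 1, p₂, 1, …)`, `p_r = (1, p₁, 1, p₃, …)` and `p_m = (p_{2M}, …, p_{4M-1})`. -/
def generator {M : ℕ} [NeZero M] (r t : ℝ) (z : ℂ) (q : CellPhases M) :
    Matrix (Fin (2 * M)) (Fin (2 * M)) ℂ :=
  Matrix.diagonal (fun k : Fin (2 * M) => if Even (k : ℕ) then (q.1 k : ℂ) else 1) * transferOdd r t z *
    Matrix.diagonal (fun k => (q.2 k : ℂ)) * transferEven r t z *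
    Matrix.diagonal (fun k : Fin (2 * M) => if Even (k : ℕ) then 1 else (q.1 k : ℂ))

/-- `Φ_z(n, ω) = A(ω (n-1)) ⋯ A(ω 0)` for `n ≥ 0`. -/
def cocycleForward {M : ℕ} [NeZero M] (r t : ℝ) (z : ℂ) (ω : ℤ → CellPhases M) :
    ℕ → Matrix (Fin (2 * M)) (Fin (2 * M)) ℂ
  | 0 => 1
  | n + 1 => generator r t z (ω (n : ℤ)) * cocycleForward r t z ω n

/-- `Φ_z(-n, ω) = A(ω (-n))⁻¹ ⋯ A(ω (-1))⁻¹` for `n ≥ 0`. -/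
def cocycleBackward {M : ℕ} [NeZero M] (r t : ℝ) (z : ℂ) (ω : ℤ → CellPhases M) :
    ℕ → Matrix (Fin (2 * M)) (Fin (2 * M)) ℂ
  | 0 => 1
  | n + 1 => (generator r t z (ω (-((n : ℤ) + 1))))⁻¹ * cocycleBackward r t z ω n

/-- The phases entering the transfer matrix from column `2j` to column `2j+2`. Solving
`U(p) ψ = z ψ` for the column `ψ_{2j+2}` in terms of `ψ_{2j}` gives
`ψ_{2j+2} = A_z(cellPhases p j) ψ_{2j}`. -/
def cellPhases {M : ℕ} (p : Phases M) (j : ℤ) : CellPhases M :=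
  (fun k => if Even (k : ℕ) then p (2 * j + 2, k) else (p (2 * j, k))⁻¹,
   fun k => if Even (k : ℕ) then p (2 * j + 1, k) else (p (2 * j + 1, k))⁻¹)

/-- The propagator `P_{2L}(z) = Φ_z(L) Φ_z(-L)⁻¹` from column `-2L` to column `2L`. -/
def propagator {M : ℕ} [NeZero M] (r t : ℝ) (p : Phases M) (z : ℂ) (L : ℕ) :
    Matrix (Fin (2 * M)) (Fin (2 * M)) ℂ :=
  cocycleForward r t z (cellPhases p) L * (cocycleBackward r t z (cellPhases p) L)⁻¹

/-- The norm `‖∧^m B‖` of the `m`-th exterior power of a matrix: the operator norm on `∧^m ℂⁿ`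
with the Hermitian structure for which the vectors `e_{i₁} ∧ ⋯ ∧ e_{i_m}`, `i₁ < ⋯ < i_m`, form an
orthonormal basis (the matrix norm used here is the `ℓ²` operator norm). -/
def exteriorPowerNorm {n : ℕ} (m : ℕ) (B : Matrix (Fin n) (Fin n) ℂ) : ℝ :=
  ‖LinearMap.toMatrix ((Pi.basisFun ℂ (Fin n)).exteriorPower m)
    ((Pi.basisFun ℂ (Fin n)).exteriorPower m) (exteriorPower.map m (Matrix.toLin' B))‖

end

end ChalkerCoddington

namespace ChalkerCoddington

/-! ### Linear algebra of traces, determinants and exterior powers -/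

/-! Everything rests on the row form of the network matrix. Each site receives amplitude from
exactly two sites, `mainSource` in its own column and `sideSource` in a neighbouring one; a wall
site receives only from its main source. Distinct rows have disjoint supports or belong to the same
scattering node, so unitarity of $U^D$ is orthogonality of the $2\times2$ scattering matrix
(`reflected_mul_star`). The eigenvalues therefore lie on the circle, and traces of functions of
$U^D$ are sums over them.

Flatness is proved through moments. Away from the walls, diagonal entries of $(U^D)^n$ equal those
of $U^n$, so the trace is a sum of column traces up to an error independent of $L$
(`norm_trace_reflected_pow_sub_le`). A column trace is a local function of the i.i.d. phases,
covariant under even translations and homogeneous of degree $n$ in the phases. Rotating all phases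
by $c$ with $c^n=-1$ shows that its mean vanishes. The strong law along well-spaced columns makes
every positive moment tend to zero, and density of trigonometric polynomials gives vague
convergence.

The norm bound computes $\det(z-U^D)$ in two ways. It is the product of $z-x$ over the eigenvalues,
hence the exponential of a logarithmic integral. On the other hand, replace the basis vectors at the
left wall by solutions propagated with transfer matrices, a change of basis of determinant one.
These solutions satisfy every equation except the wall conditions, and up to a row permutation the
rest of the matrix is triangular with explicit pivots (`norm_det_scalar_sub_reflected`). What
remains is a $2M\times2M$ boundary determinant, equal to $z^M\det(FPV)$ with $F$ and $V$ the right
and left wall conditions and $P$ the propagator. Expanding in $M\times M$ minors of $P$ bounds it by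
$\|\wedge^MP\|$ (`norm_det_boundaryMatrix_le`). Taking logarithms finishes the proof. -/

open Polynomial in
theorem det_aeval_eq_prod_roots {n : Type*} [Fintype n] [DecidableEq n] (A : Matrix n n ℂ)
    (q : ℂ[X]) : (aeval A q).det = (A.charpoly.roots.map fun x => q.eval x).prod := by
  have hcard : Multiset.card A.charpoly.roots = Fintype.card n := by
    rw [← (IsAlgClosed.splits A.charpoly).natDegree_eq_card_roots, A.charpoly_natDegree_eq_dim]
  -- The sign $(-1)^n$ between $\det(A-\beta)$ and the characteristic polynomial at $\beta$ is
  -- spread over the $n$ roots, turning each $\beta-x$ into $x-\beta$.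
  have hlin : ∀ β : ℂ, (aeval A (X - C β)).det =
      (A.charpoly.roots.map fun x => (X - C β).eval x).prod := by
    intro β
    have h1 : (aeval A (X - C β)) = -(Matrix.scalar n β - A) := by
      simp [Matrix.scalar_apply, Matrix.algebraMap_eq_diagonal, Pi.algebraMap_def]
    rw [h1, Matrix.det_neg, ← Matrix.eval_charpoly,
      (IsAlgClosed.splits A.charpoly).eval_eq_prod_roots_of_monic A.charpoly_monic, ← hcard]
    have : ∀ s : Multiset ℂ, (-1) ^ Multiset.card s * (s.map fun a => β - a).prod =
        (s.map fun x => (X - C β).eval x).prod := by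
      intro s
      induction s using Multiset.induction with
      | empty => simp
      | cons a s ih =>
        simp only [Multiset.card_cons, Multiset.map_cons, Multiset.prod_cons, ← ih]
        simp only [eval_sub, eval_X, eval_C]
        ring
    exact this _
  have hprod : ∀ s : Multiset ℂ, (aeval A (s.map fun β => X - C β).prod).det =
      (A.charpoly.roots.map fun x => ((s.map fun β => X - C β).prod).eval x).prod := by
    intro s
    induction s using Multiset.induction with
    | empty => simp
    | cons a s ih =>
      simp only [Multiset.map_cons, Multiset.prod_cons, map_mul, Matrix.det_mul, ih, hlin, eval_mul,
        Multiset.prod_map_mul]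
  conv_lhs => rw [(IsAlgClosed.splits q).eq_prod_roots]
  conv_rhs => rw [(IsAlgClosed.splits q).eq_prod_roots]
  rw [map_mul, Matrix.det_mul, hprod]
  simp only [eval_mul, Multiset.prod_map_mul]
  congr 1
  simp [Matrix.algebraMap_eq_diagonal, Pi.algebraMap_def, hcard]

-- At $c$ the characteristic polynomial of $q(A)$ is $\det((c-q)(A))$, so its roots are the $q(x)$
-- with multiplicity.
open Polynomial in
theorem trace_aeval_eq_sum_roots {n : Type*} [Fintype n] [DecidableEq n] (A : Matrix n n ℂ)
    (q : ℂ[X]) : (aeval A q).trace = (A.charpoly.roots.map fun x => q.eval x).sum := by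
  have hcp : (aeval A q).charpoly =
      ((A.charpoly.roots.map fun x => q.eval x).map fun a => X - C a).prod := by
    refine Polynomial.funext fun c => ?_
    rw [Matrix.eval_charpoly, eval_multiset_prod, Multiset.map_map, Multiset.map_map]
    have h1 : Matrix.scalar n c - aeval A q = aeval A (C c - q) := by
      simp [Matrix.scalar_apply, Matrix.algebraMap_eq_diagonal, Pi.algebraMap_def]
    rw [h1, det_aeval_eq_prod_roots]
    simp
  rw [Matrix.trace_eq_sum_roots_charpoly, hcp, roots_multiset_prod_X_sub_C]

-- The spectrum is finite, so on it $f$ agrees with a Lagrange interpolation polynomial, and the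
-- polynomial case applies.
open Polynomial in
theorem trace_cfc_eq_sum_roots {n : Type*} [Fintype n] [DecidableEq n] (A : Matrix n n ℂ)
    (hA : IsStarNormal A) (f : ℂ → ℂ) :
    (cfc f A).trace = (A.charpoly.roots.map f).sum := by
  classical
  set s := A.charpoly.roots.toFinset
  have hq : ∀ x ∈ A.charpoly.roots, (Lagrange.interpolate s id f).eval x = f x := by
    intro x hx
    exact Lagrange.eval_interpolate_at_node (v := id) f (fun a _ b _ h => h)
      (Multiset.mem_toFinset.mpr hx)
  have h1 : cfc f A = aeval A (Lagrange.interpolate s id f) := by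
    rw [← cfc_polynomial _ A hA]
    refine cfc_congr fun x hx => (hq x ?_).symm
    rw [Matrix.mem_spectrum_iff_isRoot_charpoly] at hx
    exact (mem_roots A.charpoly_monic.ne_zero).mpr hx
  rw [h1, trace_aeval_eq_sum_roots]
  exact congrArg _ (Multiset.map_congr rfl hq)

theorem trace_pow_eq_sum_roots {n : Type*} [Fintype n] [DecidableEq n] (A : Matrix n n ℂ)
    (k : ℕ) : (A ^ k).trace = (A.charpoly.roots.map fun x => x ^ k).sum := by
  simpa using trace_aeval_eq_sum_roots A (Polynomial.X ^ k)

/-- Ties in the ranking `b` are harmless when the blocks are diagonal, so later rankings need not be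
linear orders on the index set. -/
theorem det_of_blockTriangular_of_diagonal {m α R : Type*} [CommRing R] [Fintype m] [DecidableEq m]
    [LinearOrder α] {B : Matrix m m R} {b : m → α} (hB : B.BlockTriangular b)
    (hd : ∀ i j, b i = b j → i ≠ j → B i j = 0) : B.det = ∏ i, B i i := by
  rw [hB.det, ← Finset.prod_fiberwise_of_maps_to (g := b) (t := Finset.univ.image b)
    (fun i _ => Finset.mem_image_of_mem b (Finset.mem_univ i))]
  refine Finset.prod_congr rfl fun a _ => ?_
  have : B.toSquareBlock b a = Matrix.diagonal fun i => B i.1 i.1 := by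
    ext i j
    by_cases hij : i = j
    · subst hij; simp [Matrix.toSquareBlock_def]
    · rw [Matrix.diagonal_apply_ne _ hij]
      exact hd _ _ (i.2.trans j.2.symm) (fun h => hij (Subtype.ext h))
  rw [this, Matrix.det_diagonal]
  exact (Finset.prod_subtype (p := fun i => b i = a) _ (by simp) fun i => B i i).symm

/-! ### Minors and norms of exterior powers. -/

theorem norm_entry_le_l2_opNorm {m n : Type*} [Fintype m] [Fintype n] [DecidableEq n]
    (A : Matrix m n ℂ) (i : m) (j : n) : ‖A i j‖ ≤ ‖A‖ := by
  have h := Matrix.l2_opNorm_mulVec A (EuclideanSpace.single j 1)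
  rw [PiLp.norm_single, norm_one, mul_one] at h
  refine le_trans ?_ h
  refine le_trans (le_of_eq ?_) (PiLp.norm_apply_le _ i)
  simp

theorem exteriorPower_toMatrix_apply {n : ℕ} (m : ℕ) (B : Matrix (Fin n) (Fin n) ℂ)
    (s t : Set.powersetCard (Fin n) m) :
    LinearMap.toMatrix ((Pi.basisFun ℂ (Fin n)).exteriorPower m)
      ((Pi.basisFun ℂ (Fin n)).exteriorPower m) (exteriorPower.map m (Matrix.toLin' B)) s t =
    (B.submatrix (Set.powersetCard.ofFinEmbEquiv.symm s)
      (Set.powersetCard.ofFinEmbEquiv.symm t)).det := by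
  rw [LinearMap.toMatrix_apply, exteriorPower.basis_apply, exteriorPower.map_apply_ιMulti_family,
    exteriorPower.basis_repr_apply, exteriorPower.ιMulti_family,
    exteriorPower.ιMultiDual_apply_ιMulti, ← Matrix.det_transpose]
  congr 1
  ext i j
  simp

theorem norm_minor_le_exteriorPowerNorm_of_strictMono {n m : ℕ} (B : Matrix (Fin n) (Fin n) ℂ)
    (a b : Fin m ↪o Fin n) : ‖(B.submatrix a b).det‖ ≤ exteriorPowerNorm m B := by
  have h := norm_entry_le_l2_opNorm (LinearMap.toMatrix ((Pi.basisFun ℂ (Fin n)).exteriorPower m)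
      ((Pi.basisFun ℂ (Fin n)).exteriorPower m) (exteriorPower.map m (Matrix.toLin' B)))
      (Set.powersetCard.ofFinEmbEquiv a) (Set.powersetCard.ofFinEmbEquiv b)
  rw [exteriorPower_toMatrix_apply] at h
  simp only [Equiv.symm_apply_apply] at h
  unfold exteriorPowerNorm
  convert! h

theorem exists_perm_orderEmb {n m : ℕ} (a : Fin m → Fin n) (ha : Function.Injective a) :
    ∃ (σ : Equiv.Perm (Fin m)) (a' : Fin m ↪o Fin n), a = a' ∘ σ := by
  refine ⟨(Tuple.sort a)⁻¹, OrderEmbedding.ofStrictMono (a ∘ Tuple.sort a)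
    ((Tuple.monotone_sort a).strictMono_of_injective (ha.comp (Equiv.injective _))), ?_⟩
  ext i
  simp

/-- A repeated index kills the determinant; otherwise sorting the indices costs only a sign and
leaves a matrix entry of the exterior power. -/
theorem norm_minor_le_exteriorPowerNorm {ι : Type*} [Fintype ι] [DecidableEq ι] {n m : ℕ}
    (hι : Fintype.card ι = m) (B : Matrix (Fin n) (Fin n) ℂ)
    (a b : ι → Fin n) : ‖(B.submatrix a b).det‖ ≤ exteriorPowerNorm m B := by
  have hnn : 0 ≤ exteriorPowerNorm m B := norm_nonneg _
  by_cases ha : Function.Injective a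
  swap
  · obtain ⟨i, j, hij, hne⟩ := Function.not_injective_iff.mp ha
    rw [Matrix.det_zero_of_row_eq hne (by ext k; simp [hij])]
    simpa
  by_cases hb : Function.Injective b
  swap
  · obtain ⟨i, j, hij, hne⟩ := Function.not_injective_iff.mp hb
    rw [Matrix.det_zero_of_column_eq hne (by intro k; simp [hij])]
    simpa
  let e : Fin m ≃ ι := (Fintype.equivFinOfCardEq hι).symm
  obtain ⟨σ, a', ha'⟩ := exists_perm_orderEmb (a ∘ e) (ha.comp e.injective)
  obtain ⟨τ, b', hb'⟩ := exists_perm_orderEmb (b ∘ e) (hb.comp e.injective)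
  have h1 : (B.submatrix a b).det = ((B.submatrix a' b').submatrix σ τ).det := by
    rw [← Matrix.det_submatrix_equiv_self e, Matrix.submatrix_submatrix, Matrix.submatrix_submatrix,
      ha', hb']
  have h2 : (B.submatrix a' b').submatrix σ τ =
      (((B.submatrix a' b').submatrix σ id).submatrix id τ) := by simp
  rw [h1, h2, Matrix.det_permute', Matrix.det_permute]
  have hs : ∀ ρ : Equiv.Perm (Fin m), ‖((Equiv.Perm.sign ρ : ℤ) : ℂ)‖ = 1 := by
    intro ρ
    rcases Int.units_eq_one_or (Equiv.Perm.sign ρ) with h | h <;> simp [h]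
  rw [norm_mul, norm_mul, hs, hs, one_mul, one_mul]
  exact norm_minor_le_exteriorPowerNorm_of_strictMono B a' b'

/-- A crude Cauchy–Binet bound: expand multilinearly in the rows over all maps `f`, not only
increasing ones, so that the coefficients sum to a product of row sums. -/
theorem norm_det_mul_le {ι κ : Type*} [Fintype ι] [DecidableEq ι] [Fintype κ] [DecidableEq κ]
    (F : Matrix ι κ ℂ) (Q : Matrix κ ι ℂ) {K : ℝ}
    (hK : ∀ f : ι → κ, ‖(Q.submatrix f id).det‖ ≤ K) :
    ‖(F * Q).det‖ ≤ (∏ i, ∑ k, ‖F i k‖) * K := by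
  have h1 : (F * Q).det = ∑ f : ι → κ, (∏ i, F i (f i)) * (Q.submatrix f id).det := by
    have h := (Matrix.detRowAlternating (n := ι) (R := ℂ)).toMultilinearMap.map_sum
      (fun i k => F i k • Q k)
    have h2 : (fun i => ∑ k, F i k • Q k) = F * Q := by
      ext i j
      simp [Matrix.mul_apply]
    rw [h2] at h
    refine h.trans (Finset.sum_congr rfl fun f _ => ?_)
    exact (Matrix.detRowAlternating (n := ι) (R := ℂ)).toMultilinearMap.map_smul_univ
      (fun i => F i (f i)) (fun i => Q (f i))
  rw [h1, Finset.prod_univ_sum, Finset.sum_mul]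
  refine (norm_sum_le _ _).trans ?_
  rw [Fintype.piFinset_univ]
  refine Finset.sum_le_sum fun f _ => ?_
  rw [norm_mul, norm_prod]
  exact mul_le_mul_of_nonneg_left (hK f) (Finset.prod_nonneg fun _ _ => norm_nonneg _)

theorem norm_det_mul_mul_le {ι : Type*} [Fintype ι] [DecidableEq ι] {n m : ℕ}
    (hι : Fintype.card ι = m) (F : Matrix ι (Fin n) ℂ) (B : Matrix (Fin n) (Fin n) ℂ)
    (V : Matrix (Fin n) ι ℂ) :
    ‖(F * B * V).det‖ ≤
      (∏ i, ∑ k, ‖F i k‖) * ((∏ i, ∑ k, ‖V k i‖) * exteriorPowerNorm m B) := by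
  rw [Matrix.mul_assoc]
  refine norm_det_mul_le F (B * V) fun f => ?_
  rw [← Matrix.det_transpose]
  have h1 : ((B * V).submatrix f id).transpose = V.transpose * (B.submatrix f id).transpose := by
    ext i j
    simp [Matrix.mul_apply, mul_comm]
  rw [h1]
  refine norm_det_mul_le V.transpose _ fun g => ?_
  rw [← Matrix.det_transpose]
  exact norm_minor_le_exteriorPowerNorm hι B f g

/-! ### Row description of the reflected network matrix -/

theorem even_val_add_one {M : ℕ} [NeZero M] (k : Fin (2 * M)) :
    Even ((k + 1 : Fin (2 * M)) : ℕ) ↔ ¬ Even (k : ℕ) := by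
  have hM : 0 < M := Nat.pos_of_ne_zero (NeZero.ne M)
  have hk := k.2
  have h1 : ((1 : Fin (2 * M)) : ℕ) = 1 := by
    rw [Fin.val_one', Nat.mod_eq_of_lt (by omega)]
  rw [Fin.val_add, h1]
  rcases Nat.lt_or_ge ((k : ℕ) + 1) (2 * M) with h | h
  · rw [Nat.mod_eq_of_lt h, Nat.even_add_one]
  · have : (k : ℕ) + 1 = 2 * M := by omega
    rw [this, Nat.mod_self]
    simp only [Even.zero, true_iff]
    intro he
    have : Odd (2 * M) := this ▸ he.add_one
    exact (Nat.not_odd_iff_even.mpr (even_two_mul M)) this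

theorem even_val_sub_one {M : ℕ} [NeZero M] (k : Fin (2 * M)) :
    Even ((k - 1 : Fin (2 * M)) : ℕ) ↔ ¬ Even (k : ℕ) := by
  have h := even_val_add_one (k - 1)
  rw [sub_add_cancel] at h
  tauto

/-- The site in the same column whose amplitude enters the row `μ` of the network operator. -/
def mainSource {M : ℕ} [NeZero M] (μ : Site M) : Site M :=
  (μ.1, if Even μ.1 then μ.2 - 1 else μ.2 + 1)

/-- The site in a neighbouring column whose amplitude enters the row `μ` of the network
operator. -/
def sideSource {M : ℕ} (μ : Site M) : Site M :=
  (if Even (μ.2 : ℕ) then μ.1 - 1 else μ.1 + 1, μ.2)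

/-- The amplitude with which `mainSource μ` enters the row `μ`. -/
def mainCoeff {M : ℕ} (r t : ℝ) (μ : Site M) : ℝ :=
  if Even μ.1 then (if Even (μ.2 : ℕ) then t else r) else (if Even (μ.2 : ℕ) then -r else t)

/-- The amplitude with which `sideSource μ` enters the row `μ`. -/
def sideCoeff {M : ℕ} (r t : ℝ) (μ : Site M) : ℝ :=
  if Even μ.1 then (if Even (μ.2 : ℕ) then -r else t) else (if Even (μ.2 : ℕ) then t else r)

/-- The sites reached by reflection at the walls. -/
def IsWall {M : ℕ} (L : ℕ) (μ : Site M) : Prop :=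
  (μ.1 = -(2 * (L : ℤ)) ∧ Even (μ.2 : ℕ)) ∨ (μ.1 = 2 * (L : ℤ) ∧ ¬ Even (μ.2 : ℕ))

/-- The definition lists where a basis vector is sent; this is the transposed description by rows,
on which all recursions below rely. -/
theorem networkEntry_eq {M : ℕ} [NeZero M] (r t : ℝ) (p : Phases M) (μ ν : Site M) :
    networkEntry r t p μ ν = (p μ : ℂ) * ((if ν = mainSource μ then (mainCoeff r t μ : ℂ) else 0) +
      (if ν = sideSource μ then (sideCoeff r t μ : ℂ) else 0)) := by
  obtain ⟨n, k⟩ := μ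
  obtain ⟨n', k'⟩ := ν
  unfold networkEntry
  congr 1
  have hk := even_val_add_one k
  have hk1 := even_val_sub_one k
  have hk' := even_val_add_one k'
  have hk1' := even_val_sub_one k'
  have e1 : k = k' + 1 ↔ k' = k - 1 := by rw [eq_sub_iff_add_eq, eq_comm]
  have e2 : k = k' - 1 ↔ k' = k + 1 := by rw [eq_sub_iff_add_eq, eq_comm]
  have m1 : Even (n' + 1) ↔ ¬ Even n' := Int.even_add_one
  have m2 : Even (n' - 1) ↔ ¬ Even n' := Int.even_sub_one
  simp only [freeStep, mainSource, sideSource, mainCoeff, sideCoeff]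
  by_cases h1 : Even n' <;> by_cases h2 : Even (k' : ℕ) <;>
  by_cases h3 : Even n <;> by_cases h4 : Even (k : ℕ) <;>
  simp only [h1, h2, h3, h4, if_true, if_false, Pi.add_apply, Pi.single_apply, Prod.mk.injEq,
    Complex.ofReal_neg] <;>
  grind

theorem mainSource_injective {M : ℕ} [NeZero M] : Function.Injective (mainSource (M := M)) := by
  rintro ⟨n, k⟩ ⟨n', k'⟩ h
  simp only [mainSource, Prod.mk.injEq] at h
  obtain ⟨rfl, h⟩ := h
  by_cases hn : Even n
  · simpa [hn] using h
  · simpa [hn] using h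

theorem sideSource_injective {M : ℕ} : Function.Injective (sideSource (M := M)) := by
  rintro ⟨n, k⟩ ⟨n', k'⟩ h
  simp only [sideSource, Prod.mk.injEq] at h
  obtain ⟨h, rfl⟩ := h
  by_cases hn : Even (k : ℕ)
  · simpa [hn] using h
  · simpa [hn] using h

theorem mainSource_eq_sideSource_iff {M : ℕ} [NeZero M] (μ ν : Site M) :
    mainSource μ = sideSource ν ↔ (if Even (ν.2 : ℕ) then μ.1 + 1 = ν.1 else μ.1 = ν.1 + 1) ∧
      (if Even μ.1 then μ.2 = ν.2 + 1 else μ.2 + 1 = ν.2) := by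
  obtain ⟨n, k⟩ := μ
  obtain ⟨n', k'⟩ := ν
  simp only [mainSource, sideSource, Prod.mk.injEq]
  refine and_congr ?_ ?_
  · split_ifs
    · omega
    · rfl
  · split_ifs
    · rw [sub_eq_iff_eq_add]
    · rfl

/-- Two sites fed by a common link are the two outgoing links of one node, and so share both
incoming links. Rows that overlap therefore overlap in both entries. -/
theorem mainSource_eq_sideSource_comm {M : ℕ} [NeZero M] (μ ν : Site M) :
    mainSource μ = sideSource ν ↔ mainSource ν = sideSource μ := by
  rw [mainSource_eq_sideSource_iff, mainSource_eq_sideSource_iff]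
  obtain ⟨n, k⟩ := μ
  obtain ⟨n', k'⟩ := ν
  have hk := even_val_add_one k
  have hk' := even_val_add_one k'
  have m1 : Even (n' + 1) ↔ ¬ Even n' := Int.even_add_one
  have m2 : Even (n + 1) ↔ ¬ Even n := Int.even_add_one
  dsimp only
  constructor <;> rintro ⟨h1, h2⟩ <;> constructor <;> grind

/-- The two rows belong to the same node, and the rows $(t,-r)$ and $(r,t)$ of its scattering matrix
are orthogonal. -/
theorem coeff_cancel {M : ℕ} [NeZero M] (r t : ℝ) (μ ν : Site M)
    (h : mainSource μ = sideSource ν) :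
    mainCoeff r t μ * sideCoeff r t ν + sideCoeff r t μ * mainCoeff r t ν = 0 := by
  rw [mainSource_eq_sideSource_iff] at h
  obtain ⟨n, k⟩ := μ
  obtain ⟨n', k'⟩ := ν
  have hk := even_val_add_one k
  have hk' := even_val_add_one k'
  have m1 : Even (n' + 1) ↔ ¬ Even n' := Int.even_add_one
  have m2 : Even (n + 1) ↔ ¬ Even n := Int.even_add_one
  simp only [mainCoeff, sideCoeff]
  dsimp only at h
  grind

theorem coeff_sq {M : ℕ} (r t : ℝ) (h : r ^ 2 + t ^ 2 = 1) (μ : Site M) :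
    mainCoeff r t μ ^ 2 + sideCoeff r t μ ^ 2 = 1 := by
  simp only [mainCoeff, sideCoeff]
  split_ifs <;> nlinarith

open Classical in
/-- The phase in the row `μ` of the reflected matrix. -/
noncomputable def wallPhase {M : ℕ} (p : Phases M) (L : ℕ) (μ : Site M) : Circle :=
  if IsWall L μ then 1 else p μ

open Classical in
/-- The amplitude of `mainSource μ` in the row `μ` of the reflected matrix. -/
noncomputable def wallMain {M : ℕ} (r t : ℝ) (L : ℕ) (μ : Site M) : ℝ :=
  if IsWall L μ then 1 else mainCoeff r t μ

open Classical in
/-- The amplitude of `sideSource μ` in the row `μ` of the reflected matrix. -/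
noncomputable def wallSide {M : ℕ} (r t : ℝ) (L : ℕ) (μ : Site M) : ℝ :=
  if IsWall L μ then 0 else sideCoeff r t μ

theorem Box.col_bounds {L M : ℕ} (μ : Box L M) :
    -(2 * (L : ℤ)) ≤ μ.toSite.1 ∧ μ.toSite.1 ≤ 2 * (L : ℤ) := Finset.mem_Icc.mp μ.1.2

theorem Box.toSite_injective {L M : ℕ} : Function.Injective (Box.toSite (L := L) (M := M)) := by
  rintro ⟨n, k⟩ ⟨n', k'⟩ h
  simp only [Box.toSite, Prod.mk.injEq] at h
  exact Prod.ext (Subtype.ext h.1) h.2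

/-- The site of the finite cylinder with given coordinates. -/
def Box.mk {L M : ℕ} (μ : Site M) (h : -(2 * (L : ℤ)) ≤ μ.1 ∧ μ.1 ≤ 2 * (L : ℤ)) : Box L M :=
  (⟨μ.1, Finset.mem_Icc.mpr h⟩, μ.2)

@[simp] theorem Box.toSite_mk {L M : ℕ} (μ : Site M)
    (h : -(2 * (L : ℤ)) ≤ μ.1 ∧ μ.1 ≤ 2 * (L : ℤ)) : (Box.mk μ h).toSite = μ := rfl

theorem sideSource_mem {L M : ℕ} (μ : Box L M) (h : ¬ IsWall L μ.toSite) :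
    -(2 * (L : ℤ)) ≤ (sideSource μ.toSite).1 ∧ (sideSource μ.toSite).1 ≤ 2 * (L : ℤ) := by
  have hb := μ.col_bounds
  simp only [IsWall, not_or, not_and, not_not] at h
  unfold sideSource
  dsimp only
  by_cases hk : Even (μ.toSite.2 : ℕ)
  · have : μ.toSite.1 ≠ -(2 * (L : ℤ)) := fun hh => h.1 hh hk
    rw [if_pos hk]; omega
  · have : μ.toSite.1 ≠ 2 * (L : ℤ) := fun hh => hk (h.2 hh)
    rw [if_neg hk]; omega

theorem IsWall.even_col {M L : ℕ} {μ : Site M} (h : IsWall L μ) : Even μ.1 := by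
  rcases h with h | h <;> rw [h.1] <;> simp

theorem IsWall.sideSource_notMem {M L : ℕ} {μ : Site M} (h : IsWall L μ) (ν : Box L M) :
    ν.toSite ≠ sideSource μ := by
  intro hν
  have hb := ν.col_bounds
  rw [hν] at hb
  unfold sideSource at hb
  dsimp only at hb
  rcases h with h | h
  · rw [if_pos h.2, h.1] at hb; omega
  · rw [if_neg h.2, h.1] at hb; omega

/-- Reflection is defined by replacing columns. It equally replaces rows: the side source of a wall
site lies outside the box, and a reflected link is neither source of any site that is not a wall
site. -/
theorem reflected_apply {M : ℕ} [NeZero M] (r t : ℝ) (p : Phases M) (L : ℕ) (μ ν : Box L M) :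
    reflected r t p L μ ν = (wallPhase p L μ.toSite : ℂ) *
      ((if ν.toSite = mainSource μ.toSite then (wallMain r t L μ.toSite : ℂ) else 0) +
      (if ν.toSite = sideSource μ.toSite then (wallSide r t L μ.toSite : ℂ) else 0)) := by
  have hE2 : Even (2 * (L : ℤ)) := even_two_mul _
  have hE1 : Even (-(2 * (L : ℤ))) := hE2.neg
  have key : μ = (ν.1, ν.toSite.2 + 1) ↔ μ.toSite.1 = ν.toSite.1 ∧
      μ.toSite.2 - 1 = ν.toSite.2 := by
    rw [← Box.toSite_injective.eq_iff]
    simp [Box.toSite, Prod.ext_iff, sub_eq_iff_eq_add]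
  have hmain : ν.toSite = mainSource μ.toSite ↔ ν.toSite.1 = μ.toSite.1 ∧
      ν.toSite.2 = (if Even μ.toSite.1 then μ.toSite.2 - 1 else μ.toSite.2 + 1) := by
    rw [Prod.ext_iff]; rfl
  have hk1 := even_val_sub_one μ.toSite.2
  have hk2 := even_val_add_one μ.toSite.2
  have hν2 : ν.2 = ν.toSite.2 := rfl
  unfold reflected
  simp only [Matrix.of_apply, hν2, key]
  by_cases hw : IsWall L μ.toSite
  · rw [wallPhase, wallMain, wallSide, if_pos hw, if_pos hw, if_pos hw,
      if_neg (hw.sideSource_notMem ν), networkEntry_eq, if_neg (hw.sideSource_notMem ν)]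
    simp only [Circle.coe_one, one_mul, add_zero, Complex.ofReal_one]
    have he := hw.even_col
    simp only [hmain, he, if_true]
    unfold IsWall at hw
    simp only [← Nat.not_even_iff_odd]
    by_cases hm : ν.toSite.1 = μ.toSite.1 ∧ ν.toSite.2 = μ.toSite.2 - 1
    · have : ((ν.toSite.1 = -(2 * (L : ℤ)) ∧ ¬ Even (ν.toSite.2 : ℕ)) ∨
          (ν.toSite.1 = 2 * (L : ℤ) ∧ Even (ν.toSite.2 : ℕ))) := by
        rw [hm.1, hm.2]; tauto
      rw [if_pos this, if_pos hm, if_pos ⟨hm.1.symm, hm.2.symm⟩]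
    · have hm' : ¬ (μ.toSite.1 = ν.toSite.1 ∧ μ.toSite.2 - 1 = ν.toSite.2) :=
        fun h => hm ⟨h.1.symm, h.2.symm⟩
      rw [if_neg hm, if_neg hm']
      simpa using fun a b => hm ⟨a, b⟩
  · rw [wallPhase, wallMain, wallSide, if_neg hw, if_neg hw, if_neg hw, ← networkEntry_eq]
    by_cases hc : (ν.toSite.1 = -(2 * (L : ℤ)) ∧ Odd (ν.toSite.2 : ℕ)) ∨
          (ν.toSite.1 = 2 * (L : ℤ) ∧ Even (ν.toSite.2 : ℕ))
    · have heν : Even ν.toSite.1 := by rcases hc with h | h <;> rw [h.1] <;> assumption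
      rw [if_pos hc]
      have h1 : ¬ (μ.toSite.1 = ν.toSite.1 ∧ μ.toSite.2 - 1 = ν.toSite.2) := by
        rintro ⟨h1, h2⟩
        apply hw
        unfold IsWall
        rw [← Nat.not_even_iff_odd] at hc
        rw [← h1, ← h2] at hc
        tauto
      have h2 : ν.toSite ≠ mainSource μ.toSite := by
        rw [Ne, hmain]
        rintro ⟨h2, h3⟩
        rw [← h2, if_pos heν] at h3
        exact h1 ⟨h2.symm, h3.symm⟩
      have h3 : ν.toSite ≠ sideSource μ.toSite := by
        intro h3
        have hb := μ.col_bounds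
        rw [h3] at hc
        unfold sideSource at hc
        dsimp only at hc
        rw [← Nat.not_even_iff_odd] at hc
        rcases hc with ⟨hc, h4⟩ | ⟨hc, h4⟩
        · rw [if_neg h4] at hc; omega
        · rw [if_pos h4] at hc; omega
      rw [if_neg h1, networkEntry_eq, if_neg h2, if_neg h3]
      simp
    · rw [if_neg hc]

theorem sum_box_ite {L M : ℕ} (x : Site M) (h : -(2 * (L : ℤ)) ≤ x.1 ∧ x.1 ≤ 2 * (L : ℤ))
    (f : Box L M → ℂ) : (∑ ν : Box L M, if ν.toSite = x then f ν else 0) = f (Box.mk x h) := by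
  rw [Finset.sum_eq_single (Box.mk x h)]
  · simp
  · intro ν _ hν
    rw [if_neg]
    intro hx
    exact hν (Box.toSite_injective (by simpa using hx))
  · simp

/-- The vector `ψ` lives on the whole cylinder; its values outside the box do not matter, since
`wallSide` vanishes wherever the side source leaves the box. -/
theorem reflected_mulVec {M : ℕ} [NeZero M] (r t : ℝ) (p : Phases M) (L : ℕ) (ψ : Site M → ℂ)
    (μ : Box L M) :
    ∑ ν, reflected r t p L μ ν * ψ ν.toSite = (wallPhase p L μ.toSite : ℂ) *
      ((wallMain r t L μ.toSite : ℂ) * ψ (mainSource μ.toSite) +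
      (wallSide r t L μ.toSite : ℂ) * ψ (sideSource μ.toSite)) := by
  simp only [reflected_apply, mul_assoc, ← Finset.mul_sum, add_mul, Finset.sum_add_distrib,
    ite_mul, zero_mul]
  congr 2
  · exact sum_box_ite (mainSource μ.toSite) μ.col_bounds
      (fun ν => (wallMain r t L μ.toSite : ℂ) * ψ ν.toSite)
  · by_cases hw : IsWall L μ.toSite
    · simp [wallSide, hw]
    · exact sum_box_ite (sideSource μ.toSite) (sideSource_mem μ hw)
        (fun ν => (wallSide r t L μ.toSite : ℂ) * ψ ν.toSite)

theorem reflected_mul_star {M : ℕ} [NeZero M] (r t : ℝ) (h : r ^ 2 + t ^ 2 = 1) (p : Phases M)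
    (L : ℕ) : reflected r t p L * star (reflected r t p L) = 1 := by
  classical
  ext μ μ'
  rw [Matrix.mul_apply]
  simp only [Matrix.star_apply]
  -- The conjugate of row `μ'`, extended to all sites so that `reflected_mulVec` evaluates the inner
  -- product of two rows.
  let ψ : Site M → ℂ := fun x => star (wallPhase p L μ'.toSite : ℂ) *
      ((if x = mainSource μ'.toSite then (wallMain r t L μ'.toSite : ℂ) else 0) +
      (if x = sideSource μ'.toSite then (wallSide r t L μ'.toSite : ℂ) else 0))
  have h1 : ∀ ν : Box L M, star (reflected r t p L μ' ν) = ψ ν.toSite := by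
    intro ν
    simp only [ψ]
    rw [reflected_apply]
    simp only [star_mul', star_add]
    congr 2 <;> split_ifs <;> simp
  simp only [h1]
  rw [reflected_mulVec r t p L ψ μ]
  simp only [ψ, mainSource_injective.eq_iff, sideSource_injective.eq_iff]
  by_cases hμ : μ = μ'
  · subst hμ
    have hne : mainSource μ.toSite ≠ sideSource μ.toSite := by
      rw [Ne, mainSource_eq_sideSource_iff]
      rintro ⟨h1, -⟩
      split_ifs at h1 <;> omega
    rw [if_pos rfl, if_pos rfl, if_neg hne, if_neg hne.symm, Matrix.one_apply_eq]
    have hp : (wallPhase p L μ.toSite : ℂ) * star (wallPhase p L μ.toSite : ℂ) = 1 := by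
      rw [Complex.star_def, Complex.mul_conj]
      simp
    have hs : ((wallMain r t L μ.toSite : ℂ)) ^ 2 + (wallSide r t L μ.toSite : ℂ) ^ 2 = 1 := by
      norm_cast
      unfold wallMain wallSide
      split_ifs
      · simp
      · exact coeff_sq r t h _
    linear_combination ((wallMain r t L μ.toSite : ℂ) ^ 2 + (wallSide r t L μ.toSite : ℂ) ^ 2) * hp
      + hs
  · rw [Matrix.one_apply_ne hμ]
    have hμs : μ.toSite ≠ μ'.toSite := fun h => hμ (Box.toSite_injective h)
    rw [if_neg hμs, if_neg hμs]
    by_cases hms : mainSource μ.toSite = sideSource μ'.toSite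
    · have hms' := (mainSource_eq_sideSource_comm _ _).mp hms
      rw [if_pos hms, if_pos hms'.symm]
      -- Overlapping distinct rows are never wall rows: the shared site is in the box, whereas the
      -- side source of a wall site is not.
      have hmem : ∀ ν : Box L M, ∀ x : Site M, mainSource ν.toSite = sideSource x → ¬ IsWall L x := by
        intro ν x hνx hw
        exact hw.sideSource_notMem (Box.mk (mainSource ν.toSite) ν.col_bounds) hνx
      have w1 := hmem _ _ hms
      have w2 := hmem _ _ hms'
      simp only [wallMain, wallSide, w1, w2, if_false]
      have := coeff_cancel r t _ _ hms
      have hc : (mainCoeff r t μ.toSite : ℂ) * sideCoeff r t μ'.toSite +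
        sideCoeff r t μ.toSite * mainCoeff r t μ'.toSite = 0 := by exact_mod_cast this
      linear_combination (wallPhase p L μ.toSite : ℂ) * star (wallPhase p L μ'.toSite : ℂ) * hc
    · have hms' : ¬ sideSource μ.toSite = mainSource μ'.toSite :=
        fun hh => hms ((mainSource_eq_sideSource_comm _ _).mpr hh.symm)
      rw [if_neg hms, if_neg hms']
      simp

theorem reflected_mem_unitary {M : ℕ} [NeZero M] (r t : ℝ) (h : r ^ 2 + t ^ 2 = 1) (p : Phases M)
    (L : ℕ) : reflected r t p L ∈ Matrix.unitaryGroup (Box L M) ℂ :=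
  Matrix.mem_unitaryGroup_iff.mpr (reflected_mul_star r t h p L)

theorem norm_root_charpoly_reflected {M : ℕ} [NeZero M] (r t : ℝ) (h : r ^ 2 + t ^ 2 = 1)
    (p : Phases M) (L : ℕ) {x : ℂ} (hx : x ∈ (reflected r t p L).charpoly.roots) : ‖x‖ = 1 := by
  have h1 : x ∈ spectrum ℂ (reflected r t p L) :=
    Matrix.mem_spectrum_iff_isRoot_charpoly.mpr (Polynomial.isRoot_of_mem_roots hx)
  have h2 := spectrum.subset_circle_of_unitary (reflected_mem_unitary r t h p L) h1
  simpa using h2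

/-! ### The density of states as an average over eigenvalues -/

open MeasureTheory in
theorem integrable_multiset_sum_dirac {α E : Type*} [MeasurableSpace α] [MeasurableSingletonClass α]
    [NormedAddCommGroup E] (s : Multiset α) (f : α → E) :
    Integrable f (s.map Measure.dirac).sum := by
  induction s using Multiset.induction with
  | empty => simp
  | cons a s ih =>
    rw [Multiset.map_cons, Multiset.sum_cons]
    exact (integrable_dirac (by simp)).add_measure ih

open MeasureTheory in
theorem integral_multiset_sum_dirac {α E : Type*} [MeasurableSpace α] [MeasurableSingletonClass α]
    [NormedAddCommGroup E] [NormedSpace ℝ E] [CompleteSpace E] (s : Multiset α) (f : α → E) :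
    ∫ x, f x ∂(s.map Measure.dirac).sum = (s.map f).sum := by
  induction s using Multiset.induction with
  | empty => simp
  | cons a s ih =>
    rw [Multiset.map_cons, Multiset.sum_cons, Multiset.map_cons, Multiset.sum_cons,
      integral_add_measure (integrable_dirac (by simp)) (integrable_multiset_sum_dirac s f), ih,
      integral_dirac]

open MeasureTheory in
theorem measure_multiset_sum_dirac_univ {α : Type*} [MeasurableSpace α] (s : Multiset α) :
    (s.map Measure.dirac).sum Set.univ = Multiset.card s := by
  induction s using Multiset.induction with
  | empty => simp
  | cons a s ih =>
    rw [Multiset.map_cons, Multiset.sum_cons, Measure.add_apply, ih]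
    simp [add_comm]

theorem measurableEmbedding_circle_coe : MeasurableEmbedding (fun x : Circle => (x : ℂ)) := by
  have hc : Continuous (fun x : Circle => (x : ℂ)) := continuous_subtype_val
  exact (hc.isClosedEmbedding Circle.coe_injective).measurableEmbedding

open MeasureTheory in
theorem map_multiset_sum_dirac {α β : Type*} [MeasurableSpace α] [MeasurableSpace β]
    (s : Multiset α) {f : α → β} (hf : Measurable f) :
    ((s.map Measure.dirac).sum).map f = ((s.map f).map Measure.dirac).sum := by
  induction s using Multiset.induction with
  | empty => simp
  | cons a s ih =>
    simp only [Multiset.map_cons, Multiset.sum_cons]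
    rw [Measure.map_add _ _ hf, ih, Measure.map_dirac' hf]

theorem card_box (L M : ℕ) : Fintype.card (Box L M) = (4 * L + 1) * (2 * M) := by
  rw [Fintype.card_prod, Fintype.card_coe, Int.card_Icc, Fintype.card_fin]
  congr 1
  omega

theorem card_roots_reflected {M : ℕ} [NeZero M] (r t : ℝ) (p : Phases M) (L : ℕ) :
    Multiset.card (reflected r t p L).charpoly.roots = (4 * L + 1) * (2 * M) := by
  rw [← (IsAlgClosed.splits (reflected r t p L).charpoly).natDegree_eq_card_roots,
    Matrix.charpoly_natDegree_eq_dim, card_box]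

-- All eigenvalues lie on the circle, so they lift to a multiset there; its point masses push
-- forward to those on ℂ, and pulling back along an embedding undoes this.
open MeasureTheory in
theorem exists_densityOfStates_eq {M : ℕ} [NeZero M] (r t : ℝ) (h : r ^ 2 + t ^ 2 = 1)
    (p : Phases M) (L : ℕ) : ∃ s : Multiset Circle,
      s.map (fun x : Circle => (x : ℂ)) = (reflected r t p L).charpoly.roots ∧
      densityOfStates r t p L =
        ((((4 * L + 1) * (2 * M) : ℕ) : ENNReal)⁻¹) • (s.map Measure.dirac).sum := by
  obtain ⟨s, hs⟩ : ∃ s : Multiset Circle,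
      s.map (fun x : Circle => (x : ℂ)) = (reflected r t p L).charpoly.roots := by
    refine ⟨(reflected r t p L).charpoly.roots.pmap
      (fun x hx => (⟨x, mem_sphere_zero_iff_norm.mpr hx⟩ : Circle))
      (fun x hx => norm_root_charpoly_reflected r t h p L hx), ?_⟩
    exact (Multiset.map_pmap _ _ _ _).trans
      ((Multiset.pmap_eq_map _ (fun a => a) _ _).trans (Multiset.map_id' _))
  refine ⟨s, hs, ?_⟩
  rw [densityOfStates, ← hs, ← map_multiset_sum_dirac s measurableEmbedding_circle_coe.measurable,
    measurableEmbedding_circle_coe.comap_map]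

open MeasureTheory in
theorem integral_densityOfStates {M : ℕ} [NeZero M] (r t : ℝ) (h : r ^ 2 + t ^ 2 = 1)
    (p : Phases M) (L : ℕ) {E : Type*} [NormedAddCommGroup E] [NormedSpace ℝ E] [CompleteSpace E]
    (f : ℂ → E) : ∫ x : Circle, f x ∂(densityOfStates r t p L) =
      ((4 * (L : ℝ) + 1) * (2 * M))⁻¹ • ((reflected r t p L).charpoly.roots.map f).sum := by
  obtain ⟨s, hs, hd⟩ := exists_densityOfStates_eq r t h p L
  rw [hd, integral_smul_measure, integral_multiset_sum_dirac, ← hs, Multiset.map_map,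
    ENNReal.toReal_inv, ENNReal.toReal_natCast]
  congr 1
  push_cast
  rfl

open MeasureTheory in
theorem isProbabilityMeasure_densityOfStates {M : ℕ} [NeZero M] (r t : ℝ)
    (h : r ^ 2 + t ^ 2 = 1) (p : Phases M) (L : ℕ) :
    IsProbabilityMeasure (densityOfStates r t p L) := by
  obtain ⟨s, hs, hd⟩ := exists_densityOfStates_eq r t h p L
  have hcard : Multiset.card s = (4 * L + 1) * (2 * M) := by
    rw [← card_roots_reflected r t p L, ← hs, Multiset.card_map]
  refine ⟨?_⟩
  rw [hd, Measure.smul_apply, measure_multiset_sum_dirac_univ, hcard, smul_eq_mul]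
  refine ENNReal.inv_mul_cancel ?_ (ENNReal.natCast_ne_top _)
  have := NeZero.ne M
  simp [this]

theorem trace_cfc_reflected {M : ℕ} [NeZero M] (r t : ℝ) (h : r ^ 2 + t ^ 2 = 1)
    (p : Phases M) (L : ℕ) (f : ℂ → ℂ) :
    (1 / ((4 * (L : ℂ) + 1) * (2 * (M : ℂ)))) * (cfc f (reflected r t p L)).trace =
      ∫ x : Circle, f (x : ℂ) ∂(densityOfStates r t p L) := by
  have hn : IsStarNormal (reflected r t p L) :=
    isStarNormal_of_mem_unitary (reflected_mem_unitary r t h p L)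
  rw [trace_cfc_eq_sum_roots _ hn, integral_densityOfStates r t h, Complex.real_smul]
  push_cast
  rw [one_div]

/-! ### Convergence of measures on the circle from convergence of moments -/

/-- The monomial `x ↦ x ^ n` on the circle. -/
noncomputable def circleMonomial (n : ℤ) : C(Circle, ℂ) :=
  ⟨fun x => ((x ^ n : Circle) : ℂ), continuous_subtype_val.comp (continuous_zpow n)⟩

/-- Uniform density of trigonometric polynomials, carried over from the additive circle by the
exponential homeomorphism. -/
theorem exists_mem_span_circleMonomial (f : C(Circle, ℂ)) {ε : ℝ} (hε : 0 < ε) :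
    ∃ g ∈ Submodule.span ℂ (Set.range circleMonomial), ∀ x, ‖f x - g x‖ < ε := by
  let e : AddCircle (1 : ℝ) ≃ₜ Circle := AddCircle.homeomorphCircle one_ne_zero
  have htop := span_fourier_closure_eq_top (T := (1 : ℝ))
  have hmem : f.comp ⟨e, e.continuous⟩ ∈
      (Submodule.span ℂ (Set.range (fourier (T := (1 : ℝ))))).topologicalClosure := by
    rw [htop]; trivial
  rw [← SetLike.mem_coe, Submodule.topologicalClosure_coe, Metric.mem_closure_iff] at hmem
  obtain ⟨h, hh, hd⟩ := hmem ε hε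
  let ψ : C(AddCircle (1 : ℝ), ℂ) →ₗ[ℂ] C(Circle, ℂ) :=
    { toFun := fun u => u.comp ⟨e.symm, e.symm.continuous⟩
      map_add' := fun _ _ => rfl
      map_smul' := fun _ _ => rfl }
  refine ⟨ψ h, ?_, fun x => ?_⟩
  · have h1 : ψ h ∈ (Submodule.span ℂ (Set.range (fourier (T := (1 : ℝ))))).map ψ :=
      Submodule.mem_map_of_mem hh
    rw [Submodule.map_span] at h1
    refine Submodule.span_mono ?_ h1
    rintro _ ⟨_, ⟨n, rfl⟩, rfl⟩
    refine ⟨n, ?_⟩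
    ext x
    change ((x ^ n : Circle) : ℂ) = fourier n (e.symm x)
    rw [fourier_apply, AddCircle.toCircle_zsmul, ← AddCircle.homeomorphCircle_apply one_ne_zero]
    change _ = (((e (e.symm x)) ^ n : Circle) : ℂ)
    rw [e.apply_symm_apply]
  · have h2 := lt_of_le_of_lt (ContinuousMap.dist_apply_le_dist (e.symm x)) hd
    rw [dist_eq_norm] at h2
    have h3 : (f.comp ⟨e, e.continuous⟩ : C(AddCircle (1 : ℝ), ℂ)) (e.symm x) = f x := by
      change f (e (e.symm x)) = f x
      rw [e.apply_symm_apply]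
    rw [h3] at h2
    exact h2

/-! ### Moments of Haar measure and of limits. -/

instance : dl.IsMulLeftInvariant :=
  inferInstanceAs (MeasureTheory.Measure.haarMeasure ⊤).IsMulLeftInvariant

theorem exists_circle_pow_eq_neg_one {n : ℕ} (hn : n ≠ 0) : ∃ c : Circle, (c : ℂ) ^ n = -1 := by
  refine ⟨Circle.exp (Real.pi / n), ?_⟩
  have hn' : (n : ℂ) ≠ 0 := Nat.cast_ne_zero.mpr hn
  rw [Circle.coe_exp, ← Complex.exp_nat_mul]
  push_cast
  rw [← Complex.exp_pi_mul_I]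
  congr 1
  field_simp

/-- Rotation by $c$ with $c^n=-1$ preserves the measure and reverses the sign of the integrand. -/
theorem integral_pow_dl {n : ℕ} (hn : n ≠ 0) : ∫ x : Circle, (x : ℂ) ^ n ∂dl = 0 := by
  obtain ⟨c, hc⟩ := exists_circle_pow_eq_neg_one hn
  have h := MeasureTheory.integral_mul_left_eq_self (μ := dl) (fun x : Circle => (x : ℂ) ^ n) c
  simp only [Circle.coe_mul, mul_pow, hc] at h
  rw [MeasureTheory.integral_const_mul] at h
  linear_combination (-1 / 2 : ℂ) * h

theorem integrable_continuousMap_circle (ν : MeasureTheory.Measure Circle)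
    [MeasureTheory.IsFiniteMeasure ν] (f : C(Circle, ℂ)) : MeasureTheory.Integrable f ν :=
  f.continuous.integrable_of_hasCompactSupport (HasCompactSupport.of_compactSpace f)

theorem integral_circleMonomial_neg (ν : MeasureTheory.Measure Circle) (n : ℕ) :
    ∫ x, circleMonomial (-(n : ℤ)) x ∂ν = star (∫ x : Circle, (x : ℂ) ^ n ∂ν) := by
  rw [Complex.star_def, ← integral_conj]
  congr 1
  ext x
  change ((x ^ (-(n : ℤ)) : Circle) : ℂ) = _
  rw [zpow_neg, zpow_natCast, Circle.coe_inv_eq_conj, Circle.coe_pow]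

theorem integral_circleMonomial_natCast (ν : MeasureTheory.Measure Circle) (n : ℕ) :
    ∫ x, circleMonomial n x ∂ν = ∫ x : Circle, (x : ℂ) ^ n ∂ν := by
  congr 1

-- Negative moments are conjugates of positive ones and the zeroth is the total mass, so the
-- positive moments control all trigonometric polynomials.
open Filter in
theorem tendsto_integral_of_tendsto_moments (ν : ℕ → MeasureTheory.Measure Circle)
    [∀ L, MeasureTheory.IsProbabilityMeasure (ν L)]
    (h : ∀ n : ℕ, n ≠ 0 → Tendsto (fun L => ∫ x : Circle, (x : ℂ) ^ n ∂ν L) atTop (nhds 0))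
    (f : C(Circle, ℂ)) :
    Tendsto (fun L => ∫ x, f x ∂ν L) atTop (nhds (∫ x, f x ∂dl)) := by
  have hnat : ∀ n : ℕ, Tendsto (fun L => ∫ x : Circle, (x : ℂ) ^ n ∂ν L) atTop
      (nhds (∫ x : Circle, (x : ℂ) ^ n ∂dl)) := by
    intro n
    rcases eq_or_ne n 0 with rfl | hn
    · simp
    · rw [integral_pow_dl hn]; exact h n hn
  have hspan : ∀ g ∈ Submodule.span ℂ (Set.range circleMonomial),
      Tendsto (fun L => ∫ x, g x ∂ν L) atTop (nhds (∫ x, g x ∂dl)) := by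
    intro g hg
    induction hg using Submodule.span_induction with
    | mem g hg =>
      obtain ⟨n, rfl⟩ := hg
      rcases Int.eq_nat_or_neg n with ⟨k, rfl | rfl⟩
      · simp only [integral_circleMonomial_natCast]
        exact hnat k
      · simp only [integral_circleMonomial_neg]
        exact (hnat k).star
    | zero => simp
    | add u v _ _ hu hv =>
      have h1 : ∀ (m : MeasureTheory.Measure Circle) [MeasureTheory.IsFiniteMeasure m],
          ∫ x, (u + v) x ∂m = ∫ x, u x ∂m + ∫ x, v x ∂m := fun m _ =>
        MeasureTheory.integral_add (integrable_continuousMap_circle m u)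
          (integrable_continuousMap_circle m v)
      simp only [h1]
      exact hu.add hv
    | smul c u _ hu =>
      have h1 : ∀ (m : MeasureTheory.Measure Circle), ∫ x, (c • u) x ∂m = c * ∫ x, u x ∂m :=
        fun m => MeasureTheory.integral_const_mul c u
      simp only [h1]
      exact hu.const_mul c
  rw [Metric.tendsto_atTop]
  intro ε hε
  obtain ⟨g, hg, hfg⟩ := exists_mem_span_circleMonomial f (ε := ε / 3) (by positivity)
  obtain ⟨N, hN⟩ := Metric.tendsto_atTop.mp (hspan g hg) (ε / 3) (by positivity)
  have hclose : ∀ (m : MeasureTheory.Measure Circle) [MeasureTheory.IsProbabilityMeasure m],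
      dist (∫ x, f x ∂m) (∫ x, g x ∂m) ≤ ε / 3 := by
    intro m _
    rw [dist_eq_norm, ← MeasureTheory.integral_sub (integrable_continuousMap_circle m f)
      (integrable_continuousMap_circle m g)]
    refine (MeasureTheory.norm_integral_le_of_norm_le_const (C := ε / 3)
      (Eventually.of_forall fun x => (hfg x).le)).trans ?_
    simp
  refine ⟨N, fun L hL => ?_⟩
  have h1 := hclose (ν L)
  have h2 := hclose dl
  have h3 := hN L hL
  rw [dist_comm] at h2
  have h4 := dist_triangle4 (∫ x, f x ∂ν L) (∫ x, g x ∂ν L) (∫ x, g x ∂dl) (∫ x, f x ∂dl)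
  linarith

/-! ### Matrix elements of powers of the infinite network operator -/

/-- The matrix elements of the powers of the network operator on the infinite cylinder. -/
noncomputable def powEntry {M : ℕ} [NeZero M] (r t : ℝ) (p : Phases M) :
    ℕ → Site M → Site M → ℂ
  | 0, μ, ν => if μ = ν then 1 else 0
  | n + 1, μ, ν => (p μ : ℂ) * ((mainCoeff r t μ : ℂ) * powEntry r t p n (mainSource μ) ν +
      (sideCoeff r t μ : ℂ) * powEntry r t p n (sideSource μ) ν)

theorem sideSource_abs_le {M : ℕ} (μ : Site M) (c : ℤ) :
    |(sideSource μ).1 - c| ≤ |μ.1 - c| + 1 := by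
  unfold sideSource
  dsimp only
  split_ifs
  · calc |μ.1 - 1 - c| = |(μ.1 - c) + (-1)| := by ring_nf
      _ ≤ _ := (abs_add_le _ _).trans (by simp)
  · calc |μ.1 + 1 - c| = |(μ.1 - c) + 1| := by ring_nf
      _ ≤ _ := (abs_add_le _ _).trans (by simp)

/-- Each step moves by at most one column, so paths of $n$ steps from `μ` never use a wall row. -/
theorem reflected_pow_apply {M : ℕ} [NeZero M] (r t : ℝ) (p : Phases M) (L n : ℕ)
    (μ ν : Box L M) (h : |μ.toSite.1| + n ≤ 2 * (L : ℤ)) :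
    (reflected r t p L ^ n) μ ν = powEntry r t p n μ.toSite ν.toSite := by
  induction n generalizing μ with
  | zero =>
    rw [pow_zero, Matrix.one_apply, powEntry]
    simp only [Box.toSite_injective.eq_iff]
  | succ n ih =>
    push_cast at h
    have hw : ¬ IsWall L μ.toSite := by
      rintro (⟨h1, -⟩ | ⟨h1, -⟩)
      · rw [h1, abs_neg, abs_of_nonneg (by positivity)] at h; omega
      · rw [h1, abs_of_nonneg (by positivity)] at h; omega
    have hs := sideSource_abs_le μ.toSite 0
    simp only [sub_zero] at hs
    rw [pow_succ', Matrix.mul_apply, powEntry]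
    simp only [reflected_apply, mul_assoc, ← Finset.mul_sum, add_mul, Finset.sum_add_distrib,
      ite_mul, zero_mul]
    rw [wallPhase, wallMain, wallSide, if_neg hw, if_neg hw, if_neg hw]
    congr 2
    · refine (sum_box_ite (mainSource μ.toSite) μ.col_bounds
        (fun κ => (mainCoeff r t μ.toSite : ℂ) * (reflected r t p L ^ n) κ ν)).trans ?_
      rw [ih]
      · rfl
      · have : (Box.mk (L := L) (mainSource μ.toSite) μ.col_bounds).toSite.1 = μ.toSite.1 := rfl
        rw [this]
        omega
    · refine (sum_box_ite (sideSource μ.toSite) (sideSource_mem μ hw)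
        (fun κ => (sideCoeff r t μ.toSite : ℂ) * (reflected r t p L ^ n) κ ν)).trans ?_
      rw [ih]
      · rfl
      · rw [Box.toSite_mk]
        omega

theorem abs_mainCoeff_le {M : ℕ} {r t : ℝ} (h : r ^ 2 + t ^ 2 = 1) (μ : Site M) :
    |mainCoeff r t μ| ≤ 1 := by
  have := coeff_sq r t h μ
  rw [← sq_le_one_iff_abs_le_one]
  nlinarith [sq_nonneg (sideCoeff r t μ)]

theorem abs_sideCoeff_le {M : ℕ} {r t : ℝ} (h : r ^ 2 + t ^ 2 = 1) (μ : Site M) :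
    |sideCoeff r t μ| ≤ 1 := by
  have := coeff_sq r t h μ
  rw [← sq_le_one_iff_abs_le_one]
  nlinarith [sq_nonneg (mainCoeff r t μ)]

theorem norm_powEntry_le {M : ℕ} [NeZero M] {r t : ℝ} (h : r ^ 2 + t ^ 2 = 1) (p : Phases M)
    (n : ℕ) (μ ν : Site M) : ‖powEntry r t p n μ ν‖ ≤ 2 ^ n := by
  induction n generalizing μ with
  | zero => rw [powEntry]; split_ifs <;> simp
  | succ n ih =>
    rw [powEntry, norm_mul, Circle.norm_coe, one_mul, pow_succ, mul_two]
    refine (norm_add_le _ _).trans (add_le_add ?_ ?_)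
    · rw [norm_mul, Complex.norm_real, Real.norm_eq_abs]
      calc _ ≤ 1 * 2 ^ n := mul_le_mul (abs_mainCoeff_le h μ) (ih _) (norm_nonneg _) zero_le_one
        _ = _ := one_mul _
    · rw [norm_mul, Complex.norm_real, Real.norm_eq_abs]
      calc _ ≤ 1 * 2 ^ n := mul_le_mul (abs_sideCoeff_le h μ) (ih _) (norm_nonneg _) zero_le_one
        _ = _ := one_mul _

theorem measurable_powEntry {M : ℕ} [NeZero M] (r t : ℝ) (n : ℕ) (μ ν : Site M) :
    Measurable fun p : Phases M => powEntry r t p n μ ν := by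
  induction n generalizing μ with
  | zero => simp only [powEntry]; exact measurable_const
  | succ n ih =>
    simp only [powEntry]
    have h1 : Measurable fun p : Phases M => (p μ : ℂ) :=
      measurableEmbedding_circle_coe.measurable.comp (measurable_pi_apply μ)
    exact h1.mul (((ih _).const_mul _).add ((ih _).const_mul _))

theorem powEntry_congr {M : ℕ} [NeZero M] (r t : ℝ) {p p' : Phases M} (n : ℕ) (μ ν : Site M)
    (h : ∀ κ : Site M, |κ.1 - μ.1| ≤ n → p κ = p' κ) :
    powEntry r t p n μ ν = powEntry r t p' n μ ν := by
  induction n generalizing μ with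
  | zero => rfl
  | succ n ih =>
    rw [powEntry, powEntry, h μ (by simp; positivity), ih, ih]
    · intro κ hκ
      refine h κ ?_
      have h1 := sideSource_abs_le μ μ.1
      rw [sub_self, abs_zero, zero_add] at h1
      have h2 := abs_sub_le κ.1 (sideSource μ).1 μ.1
      push_cast
      omega
    · intro κ hκ
      refine h κ ?_
      have : (mainSource μ).1 = μ.1 := rfl
      rw [this] at hκ
      push_cast
      omega

/-- Each of the $n$ steps contributes exactly one phase. -/
theorem powEntry_const_mul {M : ℕ} [NeZero M] (r t : ℝ) (p : Phases M) (c : Circle) (n : ℕ)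
    (μ ν : Site M) :
    powEntry r t (fun κ => c * p κ) n μ ν = (c : ℂ) ^ n * powEntry r t p n μ ν := by
  induction n generalizing μ with
  | zero => simp [powEntry]
  | succ n ih =>
    rw [powEntry, powEntry, ih, ih, Circle.coe_mul]
    ring

/-- Translation of a site by `2 * s` columns. -/
def Site.shift {M : ℕ} (s : ℤ) (μ : Site M) : Site M := (μ.1 + 2 * s, μ.2)

theorem Site.shift_injective {M : ℕ} (s : ℤ) : Function.Injective (Site.shift (M := M) s) := by
  rintro ⟨n, k⟩ ⟨n', k'⟩ h
  simpa [Site.shift] using h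

theorem Site.even_shift {M : ℕ} (s : ℤ) (μ : Site M) : Even (Site.shift s μ).1 ↔ Even μ.1 := by
  simp [Site.shift, Int.even_add]

/-- Even and odd columns carry different nodes, hence translations by an even number of columns. -/
theorem powEntry_shift {M : ℕ} [NeZero M] (r t : ℝ) (p : Phases M) (s : ℤ) (n : ℕ)
    (μ ν : Site M) : powEntry r t p n (μ.shift s) (ν.shift s) =
      powEntry r t (fun κ => p (κ.shift s)) n μ ν := by
  induction n generalizing μ with
  | zero => simp only [powEntry, (Site.shift_injective s).eq_iff]
  | succ n ih =>
    have h1 : mainSource (μ.shift s) = (mainSource μ).shift s := by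
      unfold mainSource
      simp only [Site.even_shift]
      rfl
    have h2 : sideSource (μ.shift s) = (sideSource μ).shift s := by
      unfold sideSource Site.shift
      dsimp only
      split_ifs
      · rw [Prod.mk.injEq]; exact ⟨by ring, rfl⟩
      · rw [Prod.mk.injEq]; exact ⟨by ring, rfl⟩
    have h3 : mainCoeff r t (μ.shift s) = mainCoeff r t μ := by
      unfold mainCoeff
      simp only [Site.even_shift]
      rfl
    have h4 : sideCoeff r t (μ.shift s) = sideCoeff r t μ := by
      unfold sideCoeff
      simp only [Site.even_shift]
      rfl
    rw [powEntry, powEntry, h1, h2, h3, h4, ih, ih]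

/-- The trace of the `n`-th power of the network operator over the column `m`. -/
noncomputable def columnTrace {M : ℕ} [NeZero M] (r t : ℝ) (n : ℕ) (m : ℤ) (p : Phases M) : ℂ :=
  ∑ k : Fin (2 * M), powEntry r t p n (m, k) (m, k)

theorem norm_columnTrace_le {M : ℕ} [NeZero M] {r t : ℝ} (h : r ^ 2 + t ^ 2 = 1) (n : ℕ) (m : ℤ)
    (p : Phases M) : ‖columnTrace r t n m p‖ ≤ (2 * M) * 2 ^ n := by
  refine (norm_sum_le _ _).trans ((Finset.sum_le_sum fun k _ => norm_powEntry_le h p n _ _).trans ?_)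
  simp

/-- Only columns within distance $n$ of a wall contribute, at most $2n$ of them. Each has $2M$
diagonal entries, bounded by $1$ for the unitary matrix and by $2^n$ for `powEntry`. -/
theorem norm_trace_reflected_pow_sub_le {M : ℕ} [NeZero M] {r t : ℝ} (h : r ^ 2 + t ^ 2 = 1)
    (p : Phases M) (n L : ℕ) :
    ‖(reflected r t p L ^ n).trace -
      ∑ m ∈ Finset.Icc (-(2 * (L : ℤ))) (2 * (L : ℤ)), columnTrace r t n m p‖ ≤
      (2 * n) * ((2 * M) * (1 + 2 ^ n)) := by
  set I := Finset.Icc (-(2 * (L : ℤ))) (2 * (L : ℤ))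
  have hdiff : (reflected r t p L ^ n).trace - ∑ m ∈ I, columnTrace r t n m p =
      ∑ m : I, ∑ k : Fin (2 * M), ((reflected r t p L ^ n) (m, k) (m, k) -
        powEntry r t p n (m, k) (m, k)) := by
    rw [Matrix.trace, Fintype.sum_prod_type, ← Finset.sum_coe_sort I, ← Finset.sum_sub_distrib]
    refine Finset.sum_congr rfl fun m _ => ?_
    rw [columnTrace, ← Finset.sum_sub_distrib]
    rfl
  have hterm : ∀ m : I, ‖∑ k : Fin (2 * M), ((reflected r t p L ^ n) (m, k) (m, k) -
        powEntry r t p n (m, k) (m, k))‖ ≤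
        if 2 * (L : ℤ) < |(m : ℤ)| + n then ((2 * M) * (1 + 2 ^ n) : ℝ) else 0 := by
    intro m
    split_ifs with hm
    · refine (norm_sum_le _ _).trans ((Finset.sum_le_sum (g := fun _ => (1 + 2 ^ n : ℝ))
        fun k _ => ?_).trans ?_)
      · refine (norm_sub_le _ _).trans (add_le_add ?_ (norm_powEntry_le h p n _ _))
        exact entry_norm_bound_of_unitary
          (Submonoid.pow_mem _ (reflected_mem_unitary r t h p L) n) _ _
      · simp [mul_add]
    · rw [Finset.sum_eq_zero, norm_zero]
      intro k _
      rw [reflected_pow_apply _ _ _ _ _ _ _ (not_lt.mp hm)]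
      exact sub_self _
  rw [hdiff]
  refine (norm_sum_le _ _).trans ((Finset.sum_le_sum fun m _ => hterm m).trans ?_)
  rw [Finset.sum_coe_sort I
    (fun m : ℤ => if 2 * (L : ℤ) < |m| + n then ((2 * M) * (1 + 2 ^ n) : ℝ) else 0),
    ← Finset.sum_filter, Finset.sum_const, nsmul_eq_mul]
  refine mul_le_mul_of_nonneg_right ?_ (by positivity)
  have hsub : I.filter (fun m => 2 * (L : ℤ) < |m| + n) ⊆
      Finset.Ioc (2 * (L : ℤ) - n) (2 * L) ∪ Finset.Ico (-(2 * (L : ℤ))) (-(2 * L) + n) := by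
    intro m hm
    simp only [I, Finset.mem_filter, Finset.mem_Icc] at hm
    simp only [Finset.mem_union, Finset.mem_Ioc, Finset.mem_Ico]
    rcases abs_cases m with h | h <;> omega
  have hcard := (Finset.card_le_card hsub).trans (Finset.card_union_le _ _)
  rw [Int.card_Ioc, Int.card_Ico] at hcard
  have : (I.filter (fun m => 2 * (L : ℤ) < |m| + n)).card ≤ 2 * n := by omega
  exact_mod_cast this

/-! ### Almost sure flatness of the density of states -/

theorem measurePreserving_const_mul_phaseLaw (M : ℕ) (c : Circle) :
    MeasureTheory.MeasurePreserving (fun (p : Phases M) κ => c * p κ) (phaseLaw M) (phaseLaw M) := by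
  refine ⟨by fun_prop, ?_⟩
  unfold phaseLaw
  rw [MeasureTheory.Measure.infinitePi_map_pi (fun _ => dl) (f := fun _ x => c * x)
    (fun _ => measurable_const_mul c)]
  congr 1
  ext1 i
  exact MeasureTheory.map_mul_left_eq_self dl c

theorem measurePreserving_shift_phaseLaw (M : ℕ) (s : ℤ) :
    MeasureTheory.MeasurePreserving (fun (p : Phases M) (κ : Site M) => p (κ.shift s))
      (phaseLaw M) (phaseLaw M) := by
  refine ⟨by fun_prop, ?_⟩
  unfold phaseLaw
  exact MeasureTheory.Measure.map_infinitePi_infinitePi_of_inj (P := fun _ => dl)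
    (Site.shift_injective s)

instance (M : ℕ) : MeasureTheory.IsProbabilityMeasure (phaseLaw M) := by
  unfold phaseLaw
  infer_instance

theorem measurable_columnTrace {M : ℕ} [NeZero M] (r t : ℝ) (n : ℕ) (m : ℤ) :
    Measurable (columnTrace (M := M) r t n m) :=
  Finset.measurable_sum _ fun _ _ => measurable_powEntry r t n _ _

theorem integrable_columnTrace {M : ℕ} [NeZero M] {r t : ℝ} (h : r ^ 2 + t ^ 2 = 1) (n : ℕ)
    (m : ℤ) : MeasureTheory.Integrable (columnTrace (M := M) r t n m) (phaseLaw M) :=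
  MeasureTheory.Integrable.of_bound (measurable_columnTrace r t n m).aestronglyMeasurable
    ((2 * M) * 2 ^ n) (Filter.Eventually.of_forall fun p => norm_columnTrace_le h n m p)

theorem columnTrace_shift {M : ℕ} [NeZero M] (r t : ℝ) (n : ℕ) (m s : ℤ) (p : Phases M) :
    columnTrace r t n (m + 2 * s) p = columnTrace r t n m (fun κ => p (κ.shift s)) :=
  Finset.sum_congr rfl fun k _ => powEntry_shift r t p s n (m, k) (m, k)

/-- Multiplying every phase by $c$ with $c^n=-1$ preserves the law and changes the sign of the
trace. -/
theorem integral_columnTrace {M : ℕ} [NeZero M] (r t : ℝ) {n : ℕ} (hn : n ≠ 0) (m : ℤ) :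
    ∫ p, columnTrace (M := M) r t n m p ∂(phaseLaw M) = 0 := by
  obtain ⟨c, hc⟩ := exists_circle_pow_eq_neg_one hn
  have h1 := (measurePreserving_const_mul_phaseLaw M c).map_eq
  have h2 : ∫ p, columnTrace (M := M) r t n m p ∂(phaseLaw M) =
      ∫ p, columnTrace (M := M) r t n m (fun κ => c * p κ) ∂(phaseLaw M) := by
    conv_lhs => rw [← h1]
    exact MeasureTheory.integral_map
      (measurePreserving_const_mul_phaseLaw M c).measurable.aemeasurable
      (measurable_columnTrace r t n m).aestronglyMeasurable
  have h3 : ∀ p : Phases M, columnTrace r t n m (fun κ => c * p κ) = - columnTrace r t n m p := by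
    intro p
    simp only [columnTrace, powEntry_const_mul, hc, neg_one_mul, Finset.sum_neg_distrib]
  simp only [h3, MeasureTheory.integral_neg] at h2
  linear_combination (1 / 2 : ℂ) * h2

/-- The sites within distance `n` of the column `m`. -/
noncomputable def strip (M : ℕ) (n : ℕ) (m : ℤ) : Finset (Site M) := Finset.Icc (m - n) (m + n) ×ˢ Finset.univ

open Classical in
theorem indepFun_columnTrace {M : ℕ} [NeZero M] (r t : ℝ) (n : ℕ) {m m' : ℤ}
    (h : 2 * (n : ℤ) < |m - m'|) :
    ProbabilityTheory.IndepFun (columnTrace (M := M) r t n m) (columnTrace (M := M) r t n m')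
      (phaseLaw M) := by
  have hind : ProbabilityTheory.iIndepFun (fun (κ : Site M) (p : Phases M) => p κ) (phaseLaw M) :=
    ProbabilityTheory.iIndepFun_infinitePi (P := fun _ => dl) (X := fun _ x => x)
      (fun _ => measurable_id)
  have hdisj : Disjoint (strip M n m) (strip M n m') := by
    rw [Finset.disjoint_left]
    rintro ⟨a, k⟩ h1 h2
    simp only [strip, Finset.mem_product, Finset.mem_Icc, Finset.mem_univ, and_true] at h1 h2
    rcases abs_cases (m - m') with h3 | h3 <;> omega
  have hfin := hind.indepFun_finset (strip M n m) (strip M n m') hdisj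
    (fun κ => measurable_pi_apply κ)
  -- Phases on a strip are completed by the value one elsewhere. The column trace does not see the
  -- completion, hence is a measurable function of the strip alone.
  let ext : ∀ S : Finset (Site M), (S → Circle) → Phases M :=
    fun S q κ => if hκ : κ ∈ S then q ⟨κ, hκ⟩ else 1
  have hext : ∀ S, Measurable (ext S) := by
    intro S
    refine measurable_pi_lambda _ fun κ => ?_
    by_cases hκ : κ ∈ S
    · simp only [ext, hκ, dif_pos]; exact measurable_pi_apply _
    · simp only [ext, hκ, dif_neg, not_false_iff]; exact measurable_const
  have hloc : ∀ m : ℤ, columnTrace (M := M) r t n m =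
      (columnTrace r t n m ∘ ext (strip M n m)) ∘ fun p (κ : strip M n m) => p κ := by
    intro m
    ext p
    refine Finset.sum_congr rfl fun k _ => powEntry_congr r t n _ _ fun κ hκ => ?_
    have : κ ∈ strip M n m := by
      simp only [strip, Finset.mem_product, Finset.mem_Icc, Finset.mem_univ, and_true]
      rw [abs_le] at hκ
      dsimp only at hκ
      omega
    simp only [ext, this, dif_pos]
  rw [hloc m, hloc m']
  exact hfin.comp ((measurable_columnTrace r t n m).comp (hext _))
    ((measurable_columnTrace r t n m').comp (hext _))

-- Consecutive columns are $2|d|>2n$ apart, which gives independence; the spacing is even, which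
-- gives identical laws. The sign of `d` selects the direction along the cylinder.
open Filter in
theorem ae_tendsto_average_columnTrace {M : ℕ} [NeZero M] {r t : ℝ} (h : r ^ 2 + t ^ 2 = 1)
    {n : ℕ} (hn : n ≠ 0) (a d : ℤ) (hd : (n : ℤ) < |d|) :
    ∀ᵐ p ∂(phaseLaw M), Tendsto (fun N : ℕ => (N : ℝ)⁻¹ •
      ∑ i ∈ Finset.range N, columnTrace r t n (a + 2 * (d * i)) p) atTop (nhds 0) := by
  have hslln := ProbabilityTheory.strong_law_ae (μ := phaseLaw M)
    (fun (i : ℕ) => columnTrace r t n (a + 2 * (d * i))) (integrable_columnTrace h n _)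
    (by
      intro i j hij
      refine indepFun_columnTrace r t n ?_
      have h1 : a + 2 * (d * (i : ℤ)) - (a + 2 * (d * (j : ℤ))) = 2 * (d * ((i : ℤ) - j)) := by ring
      have h2 : 1 ≤ |(i : ℤ) - j| := Int.one_le_abs (sub_ne_zero.mpr (by exact_mod_cast hij))
      rw [h1, abs_mul, abs_mul, abs_two]
      nlinarith [abs_nonneg d])
    (by
      intro i
      refine ⟨(measurable_columnTrace r t n _).aemeasurable,
        (measurable_columnTrace r t n _).aemeasurable, ?_⟩
      have h0 : columnTrace (M := M) r t n (a + 2 * (d * (i : ℤ))) =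
          columnTrace r t n (a + 2 * (d * ((0 : ℕ) : ℤ))) ∘ fun p κ => p (κ.shift (d * i)) := by
        ext p
        simp only [Nat.cast_zero, mul_zero, add_zero]
        exact columnTrace_shift r t n a _ p
      rw [h0, ← MeasureTheory.Measure.map_map (measurable_columnTrace r t n _)
        (measurePreserving_shift_phaseLaw M _).measurable,
        (measurePreserving_shift_phaseLaw M _).map_eq])
  filter_upwards [hslln] with p hp
  rwa [integral_columnTrace r t hn] at hp

/-! ### Averages recovered from arithmetic progressions. -/

theorem sum_range_mul_eq {E : Type*} [AddCommMonoid E] (u : ℕ → E) (K q : ℕ) :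
    ∑ m ∈ Finset.range (K * q), u m =
      ∑ a ∈ Finset.range K, ∑ i ∈ Finset.range q, u (a + K * i) := by
  induction q with
  | zero => simp
  | succ q ih =>
    simp only [Finset.sum_range_succ, Finset.sum_add_distrib]
    rw [mul_add_one, Finset.sum_range_add, ih]
    simp only [add_comm]

open Filter in
theorem tendsto_average_of_residues {E : Type*} [NormedAddCommGroup E] [NormedSpace ℝ E]
    (u : ℕ → E) {C : ℝ} (hC : ∀ m, ‖u m‖ ≤ C) {K : ℕ} (hK : 0 < K)
    (h : ∀ a : ℕ, Tendsto (fun N : ℕ => (N : ℝ)⁻¹ • ∑ i ∈ Finset.range N, u (a + K * i))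
      atTop (nhds 0)) :
    Tendsto (fun N : ℕ => (N : ℝ)⁻¹ • ∑ m ∈ Finset.range N, u m) atTop (nhds 0) := by
  have hq : Tendsto (fun N : ℕ => N / K) atTop atTop := Nat.tendsto_div_const_atTop hK.ne'
  have h1 : Tendsto (fun N : ℕ => ∑ a ∈ Finset.range K, ‖(((N / K : ℕ) : ℝ)⁻¹) •
      ∑ i ∈ Finset.range (N / K), u (a + K * i)‖ + (K * C) * (N : ℝ)⁻¹) atTop (nhds 0) := by
    have h2 : Tendsto (fun N : ℕ => ∑ a ∈ Finset.range K, ‖(((N / K : ℕ) : ℝ)⁻¹) •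
      ∑ i ∈ Finset.range (N / K), u (a + K * i)‖) atTop (nhds (∑ a ∈ Finset.range K, 0)) :=
      tendsto_finsetSum _ fun a _ => by simpa using ((h a).comp hq).norm
    have h3 := (tendsto_inv_atTop_nhds_zero_nat (𝕜 := ℝ)).const_mul (K * C)
    simpa using h2.add h3
  refine squeeze_zero_norm (fun N => ?_) h1
  have hC0 : 0 ≤ C := (norm_nonneg _).trans (hC 0)
  have hsplit : ∑ m ∈ Finset.range N, u m = ∑ a ∈ Finset.range K,
      ∑ i ∈ Finset.range (N / K), u (a + K * i) +
      ∑ i ∈ Finset.range (N % K), u (K * (N / K) + i) := by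
    conv_lhs => rw [← Nat.div_add_mod N K]
    rw [Finset.sum_range_add, sum_range_mul_eq]
  rw [hsplit, smul_add]
  refine (norm_add_le _ _).trans (add_le_add ?_ ?_)
  · rw [Finset.smul_sum]
    refine (norm_sum_le _ _).trans (Finset.sum_le_sum fun a _ => ?_)
    rw [norm_smul, norm_smul]
    -- If $N<K$ the progression sums are empty; otherwise $1/N\le 1/\lfloor N/K\rfloor$.
    rcases Nat.eq_zero_or_pos (N / K) with h0 | h0
    · simp [h0]
    · refine mul_le_mul_of_nonneg_right ?_ (norm_nonneg _)
      rw [norm_inv, norm_inv, Real.norm_natCast, Real.norm_natCast]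
      refine inv_anti₀ (by exact_mod_cast h0) ?_
      exact_mod_cast Nat.div_le_self N K
  · rw [norm_smul, norm_inv, Real.norm_natCast, mul_comm]
    refine mul_le_mul_of_nonneg_right ?_ (by positivity)
    refine (norm_sum_le _ _).trans ((Finset.sum_le_sum fun i _ => hC _).trans ?_)
    rw [Finset.sum_const, Finset.card_range, nsmul_eq_mul]
    refine mul_le_mul_of_nonneg_right ?_ hC0
    exact_mod_cast (Nat.mod_lt N hK).le

theorem sum_Icc_neg_eq {E : Type*} [AddCommGroup E] (f : ℤ → E) (N : ℕ) :
    ∑ m ∈ Finset.Icc (-(N : ℤ)) N, f m =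
      ∑ i ∈ Finset.range (N + 1), f i + ∑ i ∈ Finset.range (N + 1), f (-i) - f 0 := by
  induction N with
  | zero => simp
  | succ N ih =>
    push_cast
    rw [Finset.sum_Icc_succ_eq_add_endpoints, ih, Finset.sum_range_succ _ (N + 1),
      Finset.sum_range_succ _ (N + 1)]
    push_cast
    abel

open Filter in
theorem ae_tendsto_moment {M : ℕ} [NeZero M] {r t : ℝ} (h : r ^ 2 + t ^ 2 = 1)
    {n : ℕ} (hn : n ≠ 0) :
    ∀ᵐ p ∂(phaseLaw M), Tendsto (fun L : ℕ =>
      ∫ x : Circle, (x : ℂ) ^ n ∂(densityOfStates r t p L)) atTop (nhds 0) := by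
  have hpos : ∀ᵐ p ∂(phaseLaw M), ∀ a : ℕ, Tendsto (fun N : ℕ => (N : ℝ)⁻¹ •
      ∑ i ∈ Finset.range N, columnTrace r t n ((a : ℤ) + 2 * (((n : ℤ) + 1) * i)) p)
      atTop (nhds 0) :=
    MeasureTheory.ae_all_iff.mpr fun a => ae_tendsto_average_columnTrace h hn _ _
      (by rw [abs_of_nonneg (by positivity)]; omega)
  have hneg : ∀ᵐ p ∂(phaseLaw M), ∀ a : ℕ, Tendsto (fun N : ℕ => (N : ℝ)⁻¹ •
      ∑ i ∈ Finset.range N, columnTrace r t n (-(a : ℤ) + 2 * ((-((n : ℤ) + 1)) * i)) p)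
      atTop (nhds 0) :=
    MeasureTheory.ae_all_iff.mpr fun a => ae_tendsto_average_columnTrace h hn _ _
      (by rw [abs_neg, abs_of_nonneg (by positivity)]; omega)
  filter_upwards [hpos, hneg] with p hp1 hp2
  have hb := fun m : ℤ => norm_columnTrace_le h n m p
  have h1 := tendsto_average_of_residues (fun m : ℕ => columnTrace r t n m p)
    (fun m => hb m) (K := 2 * (n + 1)) (by positivity)
    (fun a => by
      refine (hp1 a).congr fun N => ?_
      congr 1
      refine Finset.sum_congr rfl fun i _ => ?_
      congr 1
      push_cast
      ring)
  have h2 := tendsto_average_of_residues (fun m : ℕ => columnTrace r t n (-(m : ℤ)) p)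
    (fun m => hb _) (K := 2 * (n + 1)) (by positivity)
    (fun a => by
      refine (hp2 a).congr fun N => ?_
      congr 1
      refine Finset.sum_congr rfl fun i _ => ?_
      congr 1
      push_cast
      ring)
  have hsub : Tendsto (fun L : ℕ => 2 * L + 1) atTop atTop :=
    tendsto_atTop_mono (fun L => by rw [id]; omega) tendsto_id
  -- The error at the walls plus the column $0$, which both half-cylinder sums contain.
  set B : ℝ := (2 * n) * ((2 * M) * (1 + 2 ^ n)) + (2 * M) * 2 ^ n
  have hinv : Tendsto (fun L : ℕ => B * ((2 * L + 1 : ℕ) : ℝ)⁻¹) atTop (nhds 0) := by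
    simpa using ((tendsto_inv_atTop_nhds_zero_nat (𝕜 := ℝ)).comp hsub).const_mul B
  have hbound := (((h1.comp hsub).norm.add (h2.comp hsub).norm).add hinv)
  rw [norm_zero, add_zero, add_zero] at hbound
  refine squeeze_zero_norm (fun L => ?_) hbound
  rw [integral_densityOfStates r t h p L (fun x => x ^ n), ← trace_pow_eq_sum_roots, norm_smul]
  simp only [Function.comp_apply]
  rw [norm_smul, norm_smul]
  have hM : (1 : ℝ) ≤ M := by exact_mod_cast NeZero.one_le
  have hL : (0 : ℝ) ≤ L := Nat.cast_nonneg L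
  -- The number of eigenvalues exceeds $2L+1$, the number of columns in each half, so averages over
  -- the halves suffice.
  have hN : ‖((4 * (L : ℝ) + 1) * (2 * M))⁻¹‖ ≤ (((2 * L + 1 : ℕ) : ℝ))⁻¹ := by
    rw [norm_inv, Real.norm_of_nonneg (by positivity)]
    refine inv_anti₀ (by positivity) ?_
    push_cast
    nlinarith
  rw [norm_inv (((2 * L + 1 : ℕ) : ℝ)), Real.norm_natCast]
  have htr : ‖(reflected r t p L ^ n).trace‖ ≤
      ‖∑ i ∈ Finset.range (2 * L + 1), columnTrace r t n i p‖ +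
      ‖∑ i ∈ Finset.range (2 * L + 1), columnTrace r t n (-(i : ℤ)) p‖ + B := by
    have h3 := norm_trace_reflected_pow_sub_le h p n L
    have h4 := sum_Icc_neg_eq (fun m => columnTrace r t n m p) (2 * L)
    push_cast at h4
    rw [h4] at h3
    have h5 : (reflected r t p L ^ n).trace =
      ((reflected r t p L ^ n).trace - (∑ i ∈ Finset.range (2 * L + 1), columnTrace r t n i p +
        ∑ i ∈ Finset.range (2 * L + 1), columnTrace r t n (-(i : ℤ)) p - columnTrace r t n 0 p)) +
      (∑ i ∈ Finset.range (2 * L + 1), columnTrace r t n i p +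
        ∑ i ∈ Finset.range (2 * L + 1), columnTrace r t n (-(i : ℤ)) p) +
        (- columnTrace r t n 0 p) := by ring
    rw [h5]
    have h6 := hb 0
    rw [← norm_neg] at h6
    have h7 := norm_add_le (∑ i ∈ Finset.range (2 * L + 1), columnTrace r t n i p)
        (∑ i ∈ Finset.range (2 * L + 1), columnTrace r t n (-(i : ℤ)) p)
    refine (norm_add₃_le).trans ?_
    simp only [B]
    linarith
  calc _ ≤ (((2 * L + 1 : ℕ) : ℝ))⁻¹ * _ :=
        mul_le_mul hN htr (norm_nonneg _) (by positivity)
    _ = _ := by ring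

-- There are countably many moments, so one null set serves for all of them and hence for all
-- continuous functions.
open Filter in
theorem ae_tendsto_integral_densityOfStates {M : ℕ} [NeZero M] {r t : ℝ} (h : r ^ 2 + t ^ 2 = 1) :
    ∀ᵐ p ∂(phaseLaw M), ∀ f : C(Circle, ℂ), Tendsto
      (fun L : ℕ => ∫ x, f x ∂(densityOfStates r t p L)) atTop (nhds (∫ x, f x ∂dl)) := by
  have hall : ∀ᵐ p ∂(phaseLaw M), ∀ n : ℕ, n ≠ 0 → Tendsto (fun L : ℕ =>
      ∫ x : Circle, (x : ℂ) ^ n ∂(densityOfStates r t p L)) atTop (nhds 0) := by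
    rw [MeasureTheory.ae_all_iff]
    intro n
    by_cases hn : n = 0
    · exact Eventually.of_forall fun p hn' => absurd hn hn'
    · filter_upwards [ae_tendsto_moment h hn] with p hp _ using hp
  filter_upwards [hall] with p hp f
  have := fun L => isProbabilityMeasure_densityOfStates r t h p L
  exact tendsto_integral_of_tendsto_moments _ hp f

/-! ### Transfer matrices between neighbouring columns -/

theorem add_one_ne_self {M : ℕ} [NeZero M] (k : Fin (2 * M)) : k + 1 ≠ k := by
  intro h
  have := even_val_add_one k
  rw [h] at this
  tauto

theorem sub_one_ne_self {M : ℕ} [NeZero M] (k : Fin (2 * M)) : k - 1 ≠ k := by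
  intro h
  have := even_val_sub_one k
  rw [h] at this
  tauto

theorem sum_ite_ite_mul {ι : Type*} [Fintype ι] [DecidableEq ι] {a b : ι} (hab : b ≠ a) (x y : ℂ)
    (f : ι → ℂ) :
    ∑ j, (if j = a then x else if j = b then y else 0) * f j = x * f a + y * f b := by
  have h : ∀ j, (if j = a then x else if j = b then y else 0) * f j =
      (if j = a then x * f j else 0) + (if j = b then y * f j else 0) := by
    intro j
    by_cases h1 : j = a
    · subst h1
      simp [hab.symm]
    · simp [h1]
  simp [h, Finset.sum_add_distrib]

theorem transferEven_mul_apply {M : ℕ} [NeZero M] {ι : Type*} (r t : ℝ) (z : ℂ)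
    (X : Matrix (Fin (2 * M)) ι ℂ) (k : Fin (2 * M)) (c : ι) :
    (transferEven (M := M) r t z * X) k c = (t : ℂ)⁻¹ * if Even (k : ℕ) then z⁻¹ * X k c - r * X (k + 1) c
      else z * X k c - r * X (k - 1) c := by
  rw [Matrix.mul_apply]
  simp only [transferEven, Matrix.of_apply, mul_assoc, ← Finset.mul_sum]
  congr 1
  split_ifs
  · rw [sum_ite_ite_mul (add_one_ne_self k)]; ring
  · rw [sum_ite_ite_mul (sub_one_ne_self k)]; ring

theorem transferOdd_mul_apply {M : ℕ} [NeZero M] {ι : Type*} (r t : ℝ) (z : ℂ)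
    (X : Matrix (Fin (2 * M)) ι ℂ) (k : Fin (2 * M)) (c : ι) :
    (transferOdd (M := M) r t z * X) k c = (r : ℂ)⁻¹ * if Even (k : ℕ) then -z⁻¹ * X k c + t * X (k - 1) c
      else z * X k c - t * X (k + 1) c := by
  rw [Matrix.mul_apply]
  simp only [transferOdd, Matrix.of_apply, mul_assoc, ← Finset.mul_sum]
  congr 1
  split_ifs
  · rw [sum_ite_ite_mul (sub_one_ne_self k)]
  · rw [sum_ite_ite_mul (add_one_ne_self k)]; ring

/-- The transfer matrix from column `n` to column `n + 1`. -/
noncomputable def columnTransfer {M : ℕ} [NeZero M] (r t : ℝ) (p : Phases M) (z : ℂ) (n : ℤ) :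
    Matrix (Fin (2 * M)) (Fin (2 * M)) ℂ :=
  Matrix.diagonal (fun k : Fin (2 * M) => if Even (k : ℕ) then (p (n + 1, k) : ℂ) else 1) *
    (if Even n then transferEven r t z else transferOdd r t z) *
    Matrix.diagonal (fun k : Fin (2 * M) => if Even (k : ℕ) then 1 else (((p (n, k))⁻¹ : Circle) : ℂ))

theorem columnTransfer_mul_apply {M : ℕ} [NeZero M] {ι : Type*} (r t : ℝ) (p : Phases M) (z : ℂ)
    (n : ℤ) (X : Matrix (Fin (2 * M)) ι ℂ) (k : Fin (2 * M)) (c : ι) :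
    (columnTransfer r t p z n * X) k c =
      if Even n then
        (if Even (k : ℕ) then p (n + 1, k) * ((t : ℂ)⁻¹ *
          (z⁻¹ * X k c - r * ((p (n, k + 1) : ℂ)⁻¹ * X (k + 1) c)))
        else (t : ℂ)⁻¹ * (z * ((p (n, k) : ℂ)⁻¹ * X k c) - r * X (k - 1) c))
      else
        (if Even (k : ℕ) then p (n + 1, k) * ((r : ℂ)⁻¹ *
          (-z⁻¹ * X k c + t * ((p (n, k - 1) : ℂ)⁻¹ * X (k - 1) c)))
        else (r : ℂ)⁻¹ * (z * ((p (n, k) : ℂ)⁻¹ * X k c) - t * X (k + 1) c)) := by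
  have h1 := even_val_add_one k
  have h2 := even_val_sub_one k
  rw [columnTransfer, Matrix.mul_assoc, Matrix.mul_assoc, Matrix.diagonal_mul]
  by_cases hn : Even n
  · rw [if_pos hn, if_pos hn, transferEven_mul_apply]
    simp only [Matrix.diagonal_mul]
    by_cases hk : Even (k : ℕ)
    · simp [hk, h1]
    · simp [hk, h2]
  · rw [if_neg hn, if_neg hn, transferOdd_mul_apply]
    simp only [Matrix.diagonal_mul]
    by_cases hk : Even (k : ℕ)
    · simp [hk, h2]
    · simp [hk, h1]

/-- The eigenvalue equation at an even position in column $n+1$: its side source is in column $n$.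
Solving for it uses $r^2+t^2=1$. -/
theorem columnTransfer_row_even {M : ℕ} [NeZero M] {ι : Type*} {r t : ℝ} (h : r ^ 2 + t ^ 2 = 1)
    (hrt : r * t ≠ 0) (p : Phases M) {z : ℂ} (hz : z ≠ 0)
    (n : ℤ) (X : Matrix (Fin (2 * M)) ι ℂ) {k : Fin (2 * M)} (hk : Even (k : ℕ)) (c : ι) :
    z * (columnTransfer r t p z n * X) k c = p (n + 1, k) *
      (mainCoeff r t (n + 1, k) * (columnTransfer r t p z n * X) (mainSource (M := M) (n + 1, k)).2 c +
        sideCoeff r t (n + 1, k) * X k c) := by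
  have hr : (r : ℂ) ≠ 0 := by exact_mod_cast left_ne_zero_of_mul hrt
  have ht : (t : ℂ) ≠ 0 := by exact_mod_cast right_ne_zero_of_mul hrt
  have hc : (r : ℂ) ^ 2 + (t : ℂ) ^ 2 = 1 := by exact_mod_cast h
  have h1 := even_val_add_one k
  have h2 := even_val_sub_one k
  have hn1 : Even (n + 1) ↔ ¬ Even n := Int.even_add_one
  have p1 := Circle.coe_ne_zero (p (n, k + 1))
  have p2 := Circle.coe_ne_zero (p (n, k - 1))
  by_cases hn : Even n
  · have hs : (mainSource ((n + 1, k) : Site M)).2 = k + 1 := by simp [mainSource, hn1, hn]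
    rw [hs]
    simp only [columnTransfer_mul_apply, mainCoeff, sideCoeff, hn1, hn, hk, h1, not_true, if_true,
      if_false, add_sub_cancel_right, Complex.ofReal_neg]
    field_simp
    linear_combination (-X k c * p (n, k + 1)) * hc
  · have hs : (mainSource ((n + 1, k) : Site M)).2 = k - 1 := by simp [mainSource, hn1, hn]
    rw [hs]
    simp only [columnTransfer_mul_apply, mainCoeff, sideCoeff, hn1, hn, hk, h2, not_true, if_true,
      if_false, sub_add_cancel, not_false_iff, Complex.ofReal_neg]
    field_simp
    linear_combination (X k c * p (n, k - 1)) * hc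

/-- The eigenvalue equation at an odd position in column $n$, whose side source is in column $n+1$.
-/
theorem columnTransfer_row_odd {M : ℕ} [NeZero M] {ι : Type*} {r t : ℝ}
    (hrt : r * t ≠ 0) (p : Phases M) (z : ℂ)
    (n : ℤ) (X : Matrix (Fin (2 * M)) ι ℂ) {k : Fin (2 * M)} (hk : ¬ Even (k : ℕ)) (c : ι) :
    z * X k c = p (n, k) * (mainCoeff r t (n, k) * X (mainSource (M := M) (n, k)).2 c +
        sideCoeff r t (n, k) * (columnTransfer r t p z n * X) k c) := by
  have hr : (r : ℂ) ≠ 0 := by exact_mod_cast left_ne_zero_of_mul hrt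
  have ht : (t : ℂ) ≠ 0 := by exact_mod_cast right_ne_zero_of_mul hrt
  have p1 := Circle.coe_ne_zero (p (n, k))
  by_cases hn : Even n
  · have hs : (mainSource ((n, k) : Site M)).2 = k - 1 := by simp [mainSource, hn]
    rw [hs]
    simp only [columnTransfer_mul_apply, mainCoeff, sideCoeff, hn, hk, if_true, if_false]
    field_simp
    ring
  · have hs : (mainSource ((n, k) : Site M)).2 = k + 1 := by simp [mainSource, hn]
    rw [hs]
    simp only [columnTransfer_mul_apply, mainCoeff, sideCoeff, hn, hk, if_false]
    field_simp
    ring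

theorem sideCoeff_ne_zero {M : ℕ} {r t : ℝ} (hrt : r * t ≠ 0) (μ : Site M) :
    sideCoeff r t μ ≠ 0 := by
  have hr := left_ne_zero_of_mul hrt
  have ht := right_ne_zero_of_mul hrt
  unfold sideCoeff
  split_ifs <;> simp [hr, ht]

/-- For a kernel vector, the even equations in the next column force its even entries to vanish; the
odd equations in the present column then express its odd entries through these zeros. -/
theorem det_columnTransfer_ne_zero {M : ℕ} [NeZero M] {r t : ℝ} (h : r ^ 2 + t ^ 2 = 1)
    (hrt : r * t ≠ 0) (p : Phases M) {z : ℂ} (hz : z ≠ 0) (n : ℤ) :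
    (columnTransfer r t p z n).det ≠ 0 := by
  rw [Ne, ← Matrix.exists_mulVec_eq_zero_iff]
  rintro ⟨v, hv, h0⟩
  let X : Matrix (Fin (2 * M)) Unit ℂ := Matrix.of fun k _ => v k
  have hY : columnTransfer r t p z n * X = 0 := by
    ext k c
    exact congrFun h0 k
  have heven : ∀ k : Fin (2 * M), Even (k : ℕ) → v k = 0 := by
    intro k hk
    have h1 := columnTransfer_row_even h hrt p hz n X hk ()
    rw [hY] at h1
    simpa [Circle.coe_ne_zero, sideCoeff_ne_zero hrt, X] using h1
  apply hv
  ext k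
  by_cases hk : Even (k : ℕ)
  · exact heven k hk
  · have h1 := columnTransfer_row_odd hrt p z n X hk ()
    have h2 : X (mainSource (M := M) (n, k)).2 () = 0 := by
      refine heven _ ?_
      unfold mainSource
      dsimp only
      split_ifs
      · exact (even_val_sub_one k).mpr hk
      · exact (even_val_add_one k).mpr hk
    rw [hY, h2] at h1
    simpa [hz, X] using h1

/-- The middle diagonal factor splits into the odd phases used on leaving column $2j+1$ and the even
phases used on entering it. -/
theorem generator_cellPhases {M : ℕ} [NeZero M] (r t : ℝ) (p : Phases M) (z : ℂ) (j : ℤ) :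
    generator r t z (cellPhases p j) =
      columnTransfer r t p z (2 * j + 1) * columnTransfer r t p z (2 * j) := by
  have hmid : Matrix.diagonal (fun k => ((cellPhases p j).2 k : ℂ)) =
      Matrix.diagonal (fun k : Fin (2 * M) =>
        if Even (k : ℕ) then 1 else (((p (2 * j + 1, k))⁻¹ : Circle) : ℂ)) *
      Matrix.diagonal (fun k : Fin (2 * M) =>
        if Even (k : ℕ) then (p (2 * j + 1, k) : ℂ) else 1) := by
    rw [Matrix.diagonal_mul_diagonal]
    congr 1
    ext k
    simp only [cellPhases]
    split_ifs <;> simp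
  have hl : (fun k : Fin (2 * M) => if Even (k : ℕ) then ((cellPhases p j).1 k : ℂ) else 1) =
      fun k : Fin (2 * M) => if Even (k : ℕ) then (p (2 * j + 1 + 1, k) : ℂ) else 1 := by
    ext k
    simp only [cellPhases, add_assoc, one_add_one_eq_two]
    split_ifs <;> rfl
  have hr : (fun k : Fin (2 * M) => if Even (k : ℕ) then 1 else ((cellPhases p j).1 k : ℂ)) =
      fun k : Fin (2 * M) => if Even (k : ℕ) then 1 else (((p (2 * j, k))⁻¹ : Circle) : ℂ) := by
    ext k
    simp only [cellPhases]
    split_ifs <;> rfl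
  have h1 : ¬ Even (2 * j + 1) := by simp
  have h2 : Even (2 * j) := even_two_mul j
  rw [generator, hmid, hl, hr, columnTransfer, columnTransfer, if_neg h1, if_pos h2]
  simp only [Matrix.mul_assoc]

/-- The transfer matrix over `s` columns starting from column `a`. -/
noncomputable def columnTransferProd {M : ℕ} [NeZero M] (r t : ℝ) (p : Phases M) (z : ℂ) (a : ℤ) :
    ℕ → Matrix (Fin (2 * M)) (Fin (2 * M)) ℂ
  | 0 => 1
  | s + 1 => columnTransfer r t p z (a + s) * columnTransferProd r t p z a s

theorem columnTransferProd_add {M : ℕ} [NeZero M] (r t : ℝ) (p : Phases M) (z : ℂ) (a : ℤ)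
    (s s' : ℕ) : columnTransferProd r t p z a (s + s') =
      columnTransferProd r t p z (a + s) s' * columnTransferProd r t p z a s := by
  induction s' with
  | zero => simp [columnTransferProd]
  | succ s' ih =>
    rw [← add_assoc, columnTransferProd, ih, columnTransferProd, Matrix.mul_assoc]
    push_cast
    rw [add_assoc]

theorem columnTransferProd_two {M : ℕ} [NeZero M] (r t : ℝ) (p : Phases M) (z : ℂ) (j : ℤ) :
    columnTransferProd r t p z (2 * j) 2 = generator r t z (cellPhases p j) := by
  rw [generator_cellPhases]
  simp [columnTransferProd]

theorem cocycleForward_eq {M : ℕ} [NeZero M] (r t : ℝ) (p : Phases M) (z : ℂ) (n : ℕ) :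
    cocycleForward r t z (cellPhases p) n = columnTransferProd r t p z 0 (2 * n) := by
  induction n with
  | zero => rfl
  | succ n ih =>
    rw [cocycleForward, ih, mul_add_one, columnTransferProd_add, ← columnTransferProd_two]
    push_cast
    rw [zero_add]

theorem cocycleBackward_inv_eq {M : ℕ} [NeZero M] {r t : ℝ} (h : r ^ 2 + t ^ 2 = 1)
    (hrt : r * t ≠ 0) (p : Phases M) {z : ℂ} (hz : z ≠ 0) (n : ℕ) :
    (cocycleBackward r t z (cellPhases p) n)⁻¹ =
      columnTransferProd r t p z (-(2 * (n : ℤ))) (2 * n) := by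
  induction n with
  | zero => simp [cocycleBackward, columnTransferProd]
  | succ n ih =>
    -- Without invertibility the matrix inverse would take its default value and the double inverse
    -- would not cancel.
    have hunit : IsUnit (generator r t z (cellPhases p (-((n : ℤ) + 1)))).det := by
      rw [isUnit_iff_ne_zero, generator_cellPhases, Matrix.det_mul]
      exact mul_ne_zero (det_columnTransfer_ne_zero h hrt p hz _)
        (det_columnTransfer_ne_zero h hrt p hz _)
    rw [cocycleBackward, Matrix.mul_inv_rev, Matrix.nonsing_inv_nonsing_inv _ hunit, ih,
      ← columnTransferProd_two, mul_add_one, add_comm (2 * n) 2, columnTransferProd_add]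
    push_cast
    congr 2
    ring

theorem propagator_eq {M : ℕ} [NeZero M] {r t : ℝ} (h : r ^ 2 + t ^ 2 = 1)
    (hrt : r * t ≠ 0) (p : Phases M) {z : ℂ} (hz : z ≠ 0) (L : ℕ) :
    propagator r t p z L = columnTransferProd r t p z (-(2 * (L : ℤ))) (4 * L) := by
  rw [propagator, cocycleForward_eq, cocycleBackward_inv_eq h hrt p hz,
    show 4 * L = 2 * L + 2 * L by ring, columnTransferProd_add]
  push_cast
  rw [neg_add_cancel]

/-! ### The boundary determinant -/

theorem prod_range_two_mul_of_parity (x y : ℝ) (n : ℕ) :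
    ∏ s ∈ Finset.range (2 * n), (if Even s then x else y) = (x * y) ^ n := by
  induction n with
  | zero => simp
  | succ n ih =>
    rw [mul_add_one, Finset.prod_range_succ, Finset.prod_range_succ, ih, pow_succ]
    simp [mul_assoc]

theorem prod_fin_two_mul_of_parity (x y : ℝ) (M : ℕ) :
    ∏ k : Fin (2 * M), (if Even (k : ℕ) then x else y) = (x * y) ^ M := by
  rw [← prod_range_two_mul_of_parity, Finset.prod_range]

theorem card_even_fin (M : ℕ) : Fintype.card {k : Fin (2 * M) // Even (k : ℕ)} = M := by
  have h := prod_fin_two_mul_of_parity 2 1 M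
  rw [Finset.prod_ite, Finset.prod_const, Finset.prod_const_one, mul_one, mul_one] at h
  rw [Fintype.card_subtype]
  exact Nat.pow_right_injective le_rfl (by exact_mod_cast h)

theorem card_odd_fin (M : ℕ) : Fintype.card {k : Fin (2 * M) // ¬ Even (k : ℕ)} = M := by
  rw [Fintype.card_subtype_compl, card_even_fin, Fintype.card_fin]
  omega

/-- The matrix of the two reflecting boundary conditions, expressed through the column at the left
wall, when `P` is the transfer matrix from the left to the right wall. -/
def boundaryMatrix {M : ℕ} [NeZero M] (z : ℂ) (P : Matrix (Fin (2 * M)) (Fin (2 * M)) ℂ) :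
    Matrix (Fin (2 * M)) (Fin (2 * M)) ℂ :=
  Matrix.of fun k k' => if Even (k : ℕ) then z * (1 : Matrix _ _ ℂ) k k' - (1 : Matrix _ _ ℂ) (k - 1) k'
    else z * P k k' - P (k - 1) k'

/-- The left wall condition makes each even entry $z^{-1}$ times the preceding odd one. The
unipotent column operation `S` builds this in: even rows then vanish on odd columns, leaving $z^M$
times the determinant of `F * P * V`. -/
theorem norm_det_boundaryMatrix_le {M : ℕ} [NeZero M] {z : ℂ} (hz : z ≠ 0)
    (P : Matrix (Fin (2 * M)) (Fin (2 * M)) ℂ) :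
    ‖(boundaryMatrix z P).det‖ ≤
      ‖z‖ ^ M * ((1 + ‖z‖) ^ M * ((1 + ‖z‖⁻¹) ^ M * exteriorPowerNorm M P)) := by
  have e1 := even_val_add_one (M := M)
  have e2 := even_val_sub_one (M := M)
  let S : Matrix (Fin (2 * M)) (Fin (2 * M)) ℂ := Matrix.of fun k k' =>
    if k = k' then 1 else if k = k' + 1 then (if Even (k' : ℕ) then 0 else z⁻¹) else 0
  have hS : S.det = 1 := by
    rw [det_of_blockTriangular_of_diagonal (b := fun k : Fin (2 * M) => (k : ℕ) % 2)]
    · simp [S]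
    · intro i j hij
      simp only [S, Matrix.of_apply]
      have h1 : i ≠ j := by rintro rfl; exact lt_irrefl _ hij
      rw [if_neg h1]
      split_ifs with h2 h3
      · rfl
      · exfalso
        have h4 := (e1 j).mpr h3
        rw [← h2, Nat.even_iff] at h4
        dsimp only at hij
        omega
      · rfl
    · intro i j hij hne
      simp only [S, Matrix.of_apply]
      rw [if_neg hne]
      split_ifs with h2 h3
      · rfl
      · exfalso
        have h4 := (e1 j).mpr h3
        rw [← h2, Nat.even_iff] at h4
        rw [Nat.even_iff] at h3
        omega
      · rfl
  have hmul : ∀ k k', (boundaryMatrix z P * S) k k' = boundaryMatrix z P k k' +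
      (if Even (k' : ℕ) then 0 else z⁻¹) * boundaryMatrix z P k (k' + 1) := by
    intro k k'
    rw [Matrix.mul_apply]
    simp only [S, Matrix.of_apply]
    have := sum_ite_ite_mul (add_one_ne_self k') 1 (if Even (k' : ℕ) then 0 else z⁻¹)
      (boundaryMatrix z P k)
    rw [one_mul] at this
    rw [← this]
    exact Finset.sum_congr rfl fun j _ => mul_comm _ _
  have hzero : ∀ i : Fin (2 * M), ¬ ¬ Even (i : ℕ) → ∀ j : Fin (2 * M), ¬ Even (j : ℕ) →
      (boundaryMatrix z P * S) i j = 0 := by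
    intro i hi j hj
    rw [not_not] at hi
    have h1 : i ≠ j := by rintro rfl; exact hj hi
    have h2 : i - 1 ≠ j + 1 := by
      intro h
      have h3 := e1 j
      rw [← h, e2] at h3
      tauto
    rw [hmul, if_neg hj]
    simp only [boundaryMatrix, Matrix.of_apply, hi, if_true, Matrix.one_apply, h1, h2, if_false,
      ← sub_eq_iff_eq_add]
    split_ifs <;> simp [hz]
  -- `F` holds the $M$ conditions at the right wall; the columns of `V` below span the vectors
  -- allowed at the left wall.
  let F : Matrix {k : Fin (2 * M) // ¬ Even (k : ℕ)} (Fin (2 * M)) ℂ :=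
    Matrix.of fun k i => if i = k then z else if i = k.1 - 1 then -1 else 0
  let V : Matrix (Fin (2 * M)) {k : Fin (2 * M) // ¬ Even (k : ℕ)} ℂ :=
    Matrix.of fun j k => if j = k then 1 else if j = k.1 + 1 then z⁻¹ else 0
  have hodd : (boundaryMatrix z P * S).toSquareBlockProp (fun k => ¬ Even (k : ℕ)) = F * P * V := by
    have hF : ∀ k j, (F * P) k j = z * P k j - P (k.1 - 1) j := by
      intro k j
      rw [Matrix.mul_apply]
      simp only [F, Matrix.of_apply]
      rw [sum_ite_ite_mul (sub_one_ne_self k.1)]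
      ring
    ext k k'
    rw [Matrix.mul_apply]
    have h3 : ∀ j, (F * P) k j * V j k' =
        (if j = k'.1 then 1 else if j = k'.1 + 1 then z⁻¹ else 0) * (F * P) k j :=
      fun j => mul_comm _ _
    simp only [h3]
    rw [sum_ite_ite_mul (add_one_ne_self k'.1), Matrix.toSquareBlockProp_def, Matrix.of_apply, hmul,
      if_neg k'.2, hF, hF]
    simp only [boundaryMatrix, Matrix.of_apply, k.2, if_false]
    ring
  have heven : (boundaryMatrix z P * S).toSquareBlockProp (fun k => ¬ ¬ Even (k : ℕ)) =
      Matrix.diagonal fun _ => z := by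
    ext k k'
    have hk := not_not.mp k.2
    have hk' := not_not.mp k'.2
    have h2 : k.1 - 1 ≠ k'.1 := by
      intro h
      have h3 := e2 k.1
      rw [h] at h3
      tauto
    rw [Matrix.toSquareBlockProp_def, Matrix.of_apply, hmul, if_pos hk', Matrix.diagonal_apply]
    simp [boundaryMatrix, hk, Matrix.one_apply, h2, Subtype.ext_iff]
  have hdet : (boundaryMatrix z P).det = (F * P * V).det * z ^ M := by
    rw [← mul_one (boundaryMatrix z P).det, ← hS, ← Matrix.det_mul,
      Matrix.twoBlockTriangular_det _ (fun k : Fin (2 * M) => ¬ Even (k : ℕ)) hzero, hodd, heven,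
      Matrix.det_diagonal, Finset.prod_const, Finset.card_univ]
    congr 2
    simp only [not_not]
    exact card_even_fin M
  have hFs : ∀ k, ∑ i, ‖F k i‖ ≤ 1 + ‖z‖ := by
    intro k
    have h1 : ∀ i, ‖F k i‖ ≤ (if i = k.1 then ‖z‖ else 0) + (if i = k.1 - 1 then 1 else 0) := by
      intro i
      simp only [F, Matrix.of_apply]
      split_ifs <;> simp
    refine (Finset.sum_le_sum fun i _ => h1 i).trans (le_of_eq ?_)
    simp [Finset.sum_add_distrib, add_comm]
  have hVs : ∀ k, ∑ i, ‖V i k‖ ≤ 1 + ‖z‖⁻¹ := by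
    intro k
    have h1 : ∀ i, ‖V i k‖ ≤ (if i = k.1 then 1 else 0) + (if i = k.1 + 1 then ‖z‖⁻¹ else 0) := by
      intro i
      simp only [V, Matrix.of_apply]
      split_ifs <;> simp
    refine (Finset.sum_le_sum fun i _ => h1 i).trans (le_of_eq ?_)
    simp [Finset.sum_add_distrib]
  have hnn : 0 ≤ exteriorPowerNorm M P := norm_nonneg _
  have hpF : ∏ k, ∑ i, ‖F k i‖ ≤ (1 + ‖z‖) ^ M := by
    refine (Finset.prod_le_prod (fun _ _ => Finset.sum_nonneg fun _ _ => norm_nonneg _)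
      fun k _ => hFs k).trans (le_of_eq ?_)
    rw [Finset.prod_const, Finset.card_univ, card_odd_fin]
  have hpV : ∏ k, ∑ i, ‖V i k‖ ≤ (1 + ‖z‖⁻¹) ^ M := by
    refine (Finset.prod_le_prod (fun _ _ => Finset.sum_nonneg fun _ _ => norm_nonneg _)
      fun k _ => hVs k).trans (le_of_eq ?_)
    rw [Finset.prod_const, Finset.card_univ, card_odd_fin]
  rw [hdet, norm_mul, norm_pow, mul_comm]
  refine mul_le_mul_of_nonneg_left ?_ (by positivity)
  refine (norm_det_mul_mul_le (card_odd_fin M) F P V).trans ?_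
  refine mul_le_mul hpF (mul_le_mul_of_nonneg_right hpV hnn) ?_ (by positivity)
  exact mul_nonneg (Finset.prod_nonneg fun _ _ => Finset.sum_nonneg fun _ _ => norm_nonneg _) hnn

/-! ### The characteristic determinant of the reflected matrix -/

/-- Columns of solutions of the transfer equation started at the left wall, together with the
standard basis vectors of the sites off the left wall. -/
noncomputable def solutionEntry {M : ℕ} [NeZero M] (r t : ℝ) (p : Phases M) (z : ℂ) (L : ℕ)
    (x : Site M) (ν : Box L M) : ℂ :=
  if ν.toSite.1 = -(2 * (L : ℤ)) then
    columnTransferProd r t p z (-(2 * (L : ℤ))) (x.1 + 2 * L).toNat x.2 ν.toSite.2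
  else if x = ν.toSite then 1 else 0

/-- The left-wall block is the identity, since no transfer step has been made there, and all other
columns are basis vectors. -/
theorem det_solutionEntry {M : ℕ} [NeZero M] (r t : ℝ) (p : Phases M) (z : ℂ) (L : ℕ) :
    (Matrix.of fun μ ν : Box L M => solutionEntry r t p z L μ.toSite ν).det = 1 := by
  have hwall : ∀ i j : Box L M, j.toSite.1 = -(2 * (L : ℤ)) → i.toSite.1 = -(2 * (L : ℤ)) →
      solutionEntry r t p z L i.toSite j = if i.toSite.2 = j.toSite.2 then 1 else 0 := by
    intro i j hj hi
    rw [solutionEntry, if_pos hj, hi, neg_add_cancel, Int.toNat_zero, columnTransferProd,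
      Matrix.one_apply]
  rw [det_of_blockTriangular_of_diagonal
    (b := fun μ : Box L M => if μ.toSite.1 = -(2 * (L : ℤ)) then 1 else 0)]
  · refine Finset.prod_eq_one fun i _ => ?_
    rw [Matrix.of_apply]
    by_cases hi : i.toSite.1 = -(2 * (L : ℤ))
    · rw [hwall i i hi hi, if_pos rfl]
    · rw [solutionEntry, if_neg hi, if_pos rfl]
  · intro i j hij
    dsimp only at hij
    rw [Matrix.of_apply]
    by_cases hj : j.toSite.1 = -(2 * (L : ℤ))
    · rw [if_pos hj] at hij
      split_ifs at hij <;> omega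
    · rw [solutionEntry, if_neg hj, if_neg]
      intro h
      rw [h] at hij
      exact lt_irrefl _ hij
  · intro i j hij hne
    rw [Matrix.of_apply]
    by_cases hj : j.toSite.1 = -(2 * (L : ℤ))
    · have hi : i.toSite.1 = -(2 * (L : ℤ)) := by
        by_contra hi
        simp [hi, hj] at hij
      rw [hwall i j hj hi, if_neg]
      intro h
      exact hne (Box.toSite_injective (Prod.ext (hi.trans hj.symm) h))
    · rw [solutionEntry, if_neg hj, if_neg (fun h => hne (Box.toSite_injective h))]

/-- The matrix `z - U^D` in the coordinates of `solutionEntry`. -/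
noncomputable def transformed {M : ℕ} [NeZero M] (r t : ℝ) (p : Phases M) (z : ℂ) (L : ℕ) :
    Matrix (Box L M) (Box L M) ℂ :=
  (Matrix.scalar (Box L M) z - reflected r t p L) *
    Matrix.of fun μ ν : Box L M => solutionEntry r t p z L μ.toSite ν

theorem det_transformed {M : ℕ} [NeZero M] (r t : ℝ) (p : Phases M) (z : ℂ) (L : ℕ) :
    (transformed r t p z L).det = (Matrix.scalar (Box L M) z - reflected r t p L).det := by
  rw [transformed, Matrix.det_mul, det_solutionEntry, mul_one]

theorem transformed_apply {M : ℕ} [NeZero M] (r t : ℝ) (p : Phases M) (z : ℂ) (L : ℕ)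
    (μ ν : Box L M) : transformed r t p z L μ ν = z * solutionEntry r t p z L μ.toSite ν -
      (wallPhase p L μ.toSite : ℂ) *
      ((wallMain r t L μ.toSite : ℂ) * solutionEntry r t p z L (mainSource μ.toSite) ν +
      (wallSide r t L μ.toSite : ℂ) * solutionEntry r t p z L (sideSource μ.toSite) ν) := by
  rw [transformed, sub_mul, Matrix.sub_apply]
  congr 1
  · simp [Matrix.scalar_apply, Matrix.diagonal_mul]
  · exact reflected_mulVec r t p L (fun x => solutionEntry r t p z L x ν) μ

/-- A propagated column solves every bulk equation: an even row uses the transfer step into its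
column, an odd row the step out of it. -/
theorem transformed_apply_of_not_isWall {M : ℕ} [NeZero M] {r t : ℝ} (h : r ^ 2 + t ^ 2 = 1)
    (hrt : r * t ≠ 0) (p : Phases M) {z : ℂ} (hz : z ≠ 0) (L : ℕ)
    {μ ν : Box L M} (hμ : ¬ IsWall L μ.toSite) (hν : ν.toSite.1 = -(2 * (L : ℤ))) :
    transformed r t p z L μ ν = 0 := by
  rw [transformed_apply, wallPhase, wallMain, wallSide, if_neg hμ, if_neg hμ, if_neg hμ,
    sub_eq_zero]
  simp only [solutionEntry, if_pos hν]
  obtain ⟨hb1, hb2⟩ := μ.col_bounds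
  have hs := sideSource_mem μ hμ
  have hm : (mainSource μ.toSite).1 = μ.toSite.1 := rfl
  generalize μ.toSite = x at *
  obtain ⟨n, k⟩ := x
  by_cases hk : Even (k : ℕ)
  · have hsd : sideSource ((n, k) : Site M) = (n - 1, k) := by simp [sideSource, hk]
    rw [hsd] at hs ⊢
    dsimp only at *
    -- No truncation occurs in `toNat`: the side source of a site that is not a wall site stays to
    -- the right of the left wall.
    have e1 : (n + 2 * (L : ℤ)).toNat = (n - 1 + 2 * (L : ℤ)).toNat + 1 := by omega
    have e2 : -(2 * (L : ℤ)) + ((n - 1 + 2 * (L : ℤ)).toNat : ℤ) = n - 1 := by omega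
    have := columnTransfer_row_even h hrt p hz (n - 1)
      (columnTransferProd r t p z (-(2 * (L : ℤ))) (n - 1 + 2 * (L : ℤ)).toNat) hk ν.toSite.2
    rw [sub_add_cancel] at this
    rw [hm, e1, columnTransferProd, e2]
    exact this
  · have hsd : sideSource ((n, k) : Site M) = (n + 1, k) := by simp [sideSource, hk]
    rw [hsd] at hs ⊢
    dsimp only at *
    have e1 : (n + 1 + 2 * (L : ℤ)).toNat = (n + 2 * (L : ℤ)).toNat + 1 := by omega
    have e2 : -(2 * (L : ℤ)) + ((n + 2 * (L : ℤ)).toNat : ℤ) = n := by omega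
    have := columnTransfer_row_odd hrt p z n
      (columnTransferProd r t p z (-(2 * (L : ℤ))) (n + 2 * (L : ℤ)).toNat) hk ν.toSite.2
    rw [hm, e1, columnTransferProd, e2]
    exact this

theorem transformed_apply_of_isWall {M : ℕ} [NeZero M] (r t : ℝ) (p : Phases M) (z : ℂ) (L : ℕ)
    {μ ν : Box L M} (hμ : IsWall L μ.toSite) (hν : ν.toSite.1 = -(2 * (L : ℤ))) :
    transformed r t p z L μ ν =
      z * columnTransferProd r t p z (-(2 * (L : ℤ))) (μ.toSite.1 + 2 * L).toNat
        μ.toSite.2 ν.toSite.2 -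
      columnTransferProd r t p z (-(2 * (L : ℤ))) (μ.toSite.1 + 2 * L).toNat
        (μ.toSite.2 - 1) ν.toSite.2 := by
  rw [transformed_apply, wallPhase, wallMain, wallSide, if_pos hμ, if_pos hμ, if_pos hμ]
  have hm : mainSource μ.toSite = (μ.toSite.1, μ.toSite.2 - 1) := by
    simp [mainSource, hμ.even_col]
  simp [solutionEntry, hν, hm]

/-- The row containing the pivot of a column of `transformed`; the columns at the left wall are
matched with the rows at both walls. -/
def pivotRow {L M : ℕ} (μ : Box L M) : Box L M :=
  if hk : Even (μ.toSite.2 : ℕ) then μ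
  else if hn : μ.toSite.1 = -(2 * (L : ℤ)) then Box.mk (2 * (L : ℤ), μ.toSite.2) (by dsimp only; omega)
  else Box.mk (μ.toSite.1 - 1, μ.toSite.2) (by have := μ.col_bounds; dsimp only; omega)

theorem toSite_pivotRow {L M : ℕ} (μ : Box L M) : (pivotRow μ).toSite =
    if Even (μ.toSite.2 : ℕ) then μ.toSite
    else if μ.toSite.1 = -(2 * (L : ℤ)) then (2 * (L : ℤ), μ.toSite.2)
    else (μ.toSite.1 - 1, μ.toSite.2) := by
  unfold pivotRow
  split_ifs <;> rfl

theorem pivotRow_injective {L M : ℕ} : Function.Injective (pivotRow (L := L) (M := M)) := by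
  intro μ ν h
  have h1 := congrArg Box.toSite h
  rw [toSite_pivotRow, toSite_pivotRow] at h1
  apply Box.toSite_injective
  have hb := μ.col_bounds
  have hb' := ν.col_bounds
  generalize μ.toSite = x at *
  generalize ν.toSite = y at *
  obtain ⟨n, k⟩ := x
  obtain ⟨n', k'⟩ := y
  have hk : k = k' := by
    have := congrArg Prod.snd h1
    split_ifs at this <;> exact this
  subst hk
  dsimp only at *
  have h2 := congrArg Prod.fst h1
  rw [Prod.mk.injEq]
  refine ⟨?_, rfl⟩
  split_ifs at h2 <;> dsimp only at h2 <;> omega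

/-- After the row permutation the wall equations occupy exactly the left-wall indices, so zeros in
the remaining rows give a block triangular form. -/
theorem isWall_pivotRow_iff {L M : ℕ} (μ : Box L M) :
    IsWall L (pivotRow μ).toSite ↔ μ.toSite.1 = -(2 * (L : ℤ)) := by
  have hb := μ.col_bounds
  rw [toSite_pivotRow, IsWall]
  by_cases hk : Even (μ.toSite.2 : ℕ)
  · simp [hk]
  · by_cases hn : μ.toSite.1 = -(2 * (L : ℤ))
    · simp [hk, hn]
    · simp only [hk, hn, if_false, and_false, false_or, not_false_iff, and_true, iff_false]
      omega

/-- The rows of `transformed`, permuted so that the pivots are on the diagonal. -/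
noncomputable def pivoted {M : ℕ} [NeZero M] (r t : ℝ) (p : Phases M) (z : ℂ) (L : ℕ) :
    Matrix (Box L M) (Box L M) ℂ := (transformed r t p z L).submatrix pivotRow id

theorem norm_det_pivoted {M : ℕ} [NeZero M] (r t : ℝ) (p : Phases M) (z : ℂ) (L : ℕ) :
    ‖(pivoted r t p z L).det‖ = ‖(Matrix.scalar (Box L M) z - reflected r t p L).det‖ := by
  let e : Equiv.Perm (Box L M) :=
    Equiv.ofBijective pivotRow (Finite.injective_iff_bijective.mp pivotRow_injective)
  have h : pivoted r t p z L = (transformed r t p z L).submatrix e id := rfl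
  rw [h, Matrix.det_permute, norm_mul, det_transformed]
  rcases Int.units_eq_one_or (Equiv.Perm.sign e) with h | h <;> simp [h]

/-- A ranking of the sites for which the bulk of `pivoted` is triangular. -/
def pivotRank {L M : ℕ} (μ : Box L M) : ℤ :=
  -2 * μ.toSite.1 + if Even (μ.toSite.2 : ℕ) then 0 else 1

theorem pivoted_apply_bulk {M : ℕ} [NeZero M] (r t : ℝ) (p : Phases M) (z : ℂ) (L : ℕ)
    {i j : Box L M} (hi : i.toSite.1 ≠ -(2 * (L : ℤ))) (hj : j.toSite.1 ≠ -(2 * (L : ℤ))) :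
    pivoted r t p z L i j = z * (if (pivotRow i).toSite = j.toSite then 1 else 0) -
      (p (pivotRow i).toSite : ℂ) * ((mainCoeff r t (pivotRow i).toSite : ℂ) *
        (if mainSource (pivotRow i).toSite = j.toSite then 1 else 0) +
        (sideCoeff r t (pivotRow i).toSite : ℂ) *
        (if sideSource (pivotRow i).toSite = j.toSite then 1 else 0)) := by
  have hw : ¬ IsWall L (pivotRow i).toSite := fun h => hi ((isWall_pivotRow_iff i).mp h)
  rw [pivoted, Matrix.submatrix_apply, id, transformed_apply, wallPhase, wallMain, wallSide,
    if_neg hw, if_neg hw, if_neg hw]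
  simp only [solutionEntry, if_neg hj]

/-- For even $k$, row $(n,k)$ has its pivot there at rank $-2n$, and its two sources have ranks
$-2n+1$ and $-2n+2$. For odd $k$ the row used is that of $(n-1,k)$: its side source is the pivot,
and the other entries again have larger rank. -/
theorem pivoted_eq_zero_of_rank_le {M : ℕ} [NeZero M] (r t : ℝ) (p : Phases M) (z : ℂ) (L : ℕ)
    {i j : Box L M} (hi : i.toSite.1 ≠ -(2 * (L : ℤ))) (hj : j.toSite.1 ≠ -(2 * (L : ℤ)))
    (hij : i ≠ j) (hr : pivotRank j ≤ pivotRank i) : pivoted r t p z L i j = 0 := by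
  have hne : i.toSite ≠ j.toSite := fun h => hij (Box.toSite_injective h)
  rw [pivoted_apply_bulk r t p z L hi hj]
  rw [toSite_pivotRow, if_neg hi]
  unfold pivotRank at hr
  generalize i.toSite = x at *
  generalize j.toSite = y at *
  obtain ⟨n, k⟩ := x
  obtain ⟨n', k'⟩ := y
  have h1 := even_val_add_one k
  have h2 := even_val_sub_one k
  dsimp only at *
  by_cases hk : Even (k : ℕ)
  · simp only [hk, if_true] at hr ⊢
    have a1 : mainSource ((n, k) : Site M) ≠ (n', k') := by
      unfold mainSource
      dsimp only
      rw [Ne, Prod.mk.injEq]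
      rintro ⟨rfl, rfl⟩
      split_ifs at hr <;> first | omega | tauto
    have a2 : sideSource ((n, k) : Site M) ≠ (n', k') := by
      unfold sideSource
      dsimp only
      rw [Ne, Prod.mk.injEq, if_pos hk]
      rintro ⟨rfl, rfl⟩
      rw [if_pos hk] at hr
      omega
    simp [hne, a1, a2]
  · simp only [hk, if_false] at hr ⊢
    have a0 : ((n - 1, k) : Site M) ≠ (n', k') := by
      rw [Ne, Prod.mk.injEq]
      rintro ⟨rfl, rfl⟩
      rw [if_neg hk] at hr
      omega
    have a1 : mainSource ((n - 1, k) : Site M) ≠ (n', k') := by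
      unfold mainSource
      dsimp only
      rw [Ne, Prod.mk.injEq]
      rintro ⟨rfl, rfl⟩
      split_ifs at hr <;> omega
    have a2 : sideSource ((n - 1, k) : Site M) ≠ (n', k') := by
      unfold sideSource
      dsimp only
      rw [if_neg hk, sub_add_cancel]
      exact hne
    simp [a0, a1, a2]

/-- The modulus of the diagonal entries of the bulk of `pivoted`. -/
noncomputable def pivotNorm {M : ℕ} (r t : ℝ) (z : ℂ) (μ : Site M) : ℝ :=
  if Even (μ.2 : ℕ) then ‖z‖ else if Even μ.1 then r else t

theorem norm_pivoted_diag {M : ℕ} [NeZero M] {r t : ℝ} (hr : 0 ≤ r) (ht : 0 ≤ t) (p : Phases M)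
    (z : ℂ) (L : ℕ) {i : Box L M} (hi : i.toSite.1 ≠ -(2 * (L : ℤ))) :
    ‖pivoted r t p z L i i‖ = pivotNorm r t z i.toSite := by
  rw [pivoted_apply_bulk r t p z L hi hi, toSite_pivotRow, if_neg hi, pivotNorm]
  generalize i.toSite = x at *
  obtain ⟨n, k⟩ := x
  have hk1 := add_one_ne_self k
  have hk2 := sub_one_ne_self k
  dsimp only at *
  by_cases hk : Even (k : ℕ)
  · simp only [hk, if_true]
    have a1 : mainSource ((n, k) : Site M) ≠ (n, k) := by
      unfold mainSource
      dsimp only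
      rw [Ne, Prod.mk.injEq]
      rintro ⟨-, h⟩
      split_ifs at h <;> tauto
    have a2 : sideSource ((n, k) : Site M) ≠ (n, k) := by
      unfold sideSource
      dsimp only
      rw [Ne, Prod.mk.injEq]
      rintro ⟨h, -⟩
      rw [if_pos hk] at h
      omega
    simp [a1, a2]
  · simp only [hk, if_false]
    have a0 : ((n - 1, k) : Site M) ≠ (n, k) := by
      rw [Ne, Prod.mk.injEq]
      rintro ⟨h, -⟩
      omega
    have a1 : mainSource ((n - 1, k) : Site M) ≠ (n, k) := by
      unfold mainSource
      dsimp only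
      rw [Ne, Prod.mk.injEq]
      rintro ⟨h, -⟩
      omega
    have a2 : sideSource ((n - 1, k) : Site M) = (n, k) := by
      unfold sideSource
      dsimp only
      rw [if_neg hk, sub_add_cancel]
    have hs : ‖(sideCoeff r t ((n - 1, k) : Site M) : ℂ)‖ = if Even n then r else t := by
      rw [Complex.norm_real, Real.norm_eq_abs]
      unfold sideCoeff
      simp only [hk, if_false, Int.even_sub_one]
      by_cases hn : Even n
      · simp [hn, abs_of_nonneg hr]
      · simp [hn, abs_of_nonneg ht]
    rw [if_neg a0, if_neg a1, if_pos a2]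
    simp only [mul_zero, zero_sub, zero_add, mul_one, norm_neg, norm_mul, Circle.norm_coe, one_mul]
    exact hs

/-- Of the $4L$ columns off the left wall half are even and half odd. Each gives $|z|^M$, together
with $r^M$ or $t^M$ respectively. -/
theorem prod_pivotNorm {M : ℕ} (r t : ℝ) (z : ℂ) (L : ℕ) :
    ∏ i : {i : Box L M // ¬ i.toSite.1 = -(2 * (L : ℤ))}, pivotNorm r t z i.1.toSite =
      ‖z‖ ^ (4 * L * M) * (r * t) ^ (2 * L * M) := by
  have hcol : ∀ m : ℤ, ∏ k : Fin (2 * M), pivotNorm r t z ((m, k) : Site M) =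
      (‖z‖ * if Even m then r else t) ^ M := by
    intro m
    rw [← prod_fin_two_mul_of_parity]
    rfl
  have h1 : ∏ i : {i : Box L M // ¬ i.toSite.1 = -(2 * (L : ℤ))}, pivotNorm r t z i.1.toSite =
      ∏ i : Box L M, if i.toSite.1 = -(2 * (L : ℤ)) then 1 else pivotNorm r t z i.toSite := by
    rw [Finset.prod_ite, Finset.prod_const_one, one_mul]
    exact (Finset.prod_subtype (p := fun i : Box L M => ¬ i.toSite.1 = -(2 * (L : ℤ))) _
      (by simp) fun i => pivotNorm r t z i.toSite).symm
  rw [h1, Fintype.prod_prod_type]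
  have h2 : ∀ m : Finset.Icc (-(2 * (L : ℤ))) (2 * (L : ℤ)), (∏ k : Fin (2 * M),
      if (Box.toSite (L := L) (m, k)).1 = -(2 * (L : ℤ)) then 1
        else pivotNorm r t z (Box.toSite (L := L) (m, k))) =
      (fun m : ℤ => if m = -(2 * (L : ℤ)) then 1 else (‖z‖ * if Even m then r else t) ^ M) m := by
    intro m
    by_cases hm : (m : ℤ) = -(2 * (L : ℤ))
    · exact (Finset.prod_eq_one fun k _ => if_pos hm).trans (if_pos hm).symm
    · dsimp only
      rw [if_neg hm, ← hcol]
      exact Finset.prod_congr rfl fun k _ => if_neg hm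
  rw [Finset.prod_congr rfl fun m _ => h2 m, Finset.prod_coe_sort (Finset.Icc _ _)
    (fun m : ℤ => if m = -(2 * (L : ℤ)) then 1 else (‖z‖ * if Even m then r else t) ^ M)]
  have h3 : ∏ m ∈ Finset.Icc (-(2 * (L : ℤ))) (2 * (L : ℤ)),
      (if m = -(2 * (L : ℤ)) then 1 else (‖z‖ * if Even m then r else t) ^ M) =
      ∏ s ∈ Finset.range (2 * (2 * L) + 1), (if -(2 * (L : ℤ)) + s = -(2 * (L : ℤ)) then 1
        else (‖z‖ * if Even (-(2 * (L : ℤ)) + s) then r else t) ^ M) := by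
    refine Finset.prod_nbij' (fun m => (m + 2 * L).toNat) (fun s => -(2 * (L : ℤ)) + s) ?_ ?_ ?_ ?_ ?_
    · intro m hm; rw [Finset.mem_Icc] at hm; rw [Finset.mem_range]; omega
    · intro s hs; rw [Finset.mem_range] at hs; rw [Finset.mem_Icc]; omega
    · intro m hm; rw [Finset.mem_Icc] at hm; omega
    · intro s hs; omega
    · intro m hm
      rw [Finset.mem_Icc] at hm
      have : -(2 * (L : ℤ)) + ((m + 2 * L).toNat : ℤ) = m := by omega
      rw [this]
  -- Columns are counted from the left wall. The term $s=0$ is the wall and equals one; removing it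
  -- swaps parities, so the first remaining factor carries $t$.
  rw [h3, Finset.prod_range_succ']
  have h4 : ∀ s : ℕ, (if -(2 * (L : ℤ)) + ((s + 1 : ℕ) : ℤ) = -(2 * (L : ℤ)) then 1
        else (‖z‖ * if Even (-(2 * (L : ℤ)) + ((s + 1 : ℕ) : ℤ)) then r else t) ^ M) =
      if Even s then (‖z‖ * t) ^ M else (‖z‖ * r) ^ M := by
    intro s
    have he : Even (-(2 * (L : ℤ)) + ((s + 1 : ℕ) : ℤ)) ↔ ¬ Even s := by
      push_cast
      simp [Int.even_add]
    rw [if_neg (by push_cast; omega)]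
    simp only [he]
    split_ifs <;> rfl
  rw [Finset.prod_congr rfl fun s _ => h4 s, prod_range_two_mul_of_parity]
  simp only [Nat.cast_zero, add_zero, if_true, mul_one]
  rw [← mul_pow, ← pow_mul, show ‖z‖ * t * (‖z‖ * r) = ‖z‖ ^ 2 * (r * t) by ring, mul_pow, ← pow_mul]
  congr 2 <;> ring

theorem norm_det_pivoted_bulk {M : ℕ} [NeZero M] {r t : ℝ} (hr : 0 ≤ r) (ht : 0 ≤ t)
    (p : Phases M) (z : ℂ) (L : ℕ) :
    ‖((pivoted r t p z L).toSquareBlockProp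
      fun i : Box L M => ¬ i.toSite.1 = -(2 * (L : ℤ))).det‖ =
      ‖z‖ ^ (4 * L * M) * (r * t) ^ (2 * L * M) := by
  have hzero : ∀ i j : {i : Box L M // ¬ i.toSite.1 = -(2 * (L : ℤ))}, i ≠ j →
      pivotRank j.1 ≤ pivotRank i.1 → (pivoted r t p z L).toSquareBlockProp
      (fun i : Box L M => ¬ i.toSite.1 = -(2 * (L : ℤ))) i j = 0 := by
    intro i j hne hij
    rw [Matrix.toSquareBlockProp_def, Matrix.of_apply]
    exact pivoted_eq_zero_of_rank_le r t p z L i.2 j.2 (fun h => hne (Subtype.ext h)) hij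
  rw [det_of_blockTriangular_of_diagonal
    (b := fun i : {i : Box L M // ¬ i.toSite.1 = -(2 * (L : ℤ))} => pivotRank i.1)
    (fun i j hij => hzero i j (fun h => lt_irrefl _ (h ▸ hij)) (le_of_lt hij))
    (fun i j hij hne => hzero i j hne (le_of_eq hij.symm)), norm_prod, ← prod_pivotNorm]
  refine Finset.prod_congr rfl fun i _ => ?_
  rw [Matrix.toSquareBlockProp_def, Matrix.of_apply]
  exact norm_pivoted_diag hr ht p z L i.2

/-- The off-wall rows vanish on the left-wall columns, so the determinant factors into the boundary
matrix of the propagator and the triangular bulk. -/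
theorem norm_det_scalar_sub_reflected {M : ℕ} [NeZero M] {r t : ℝ} (hr : 0 ≤ r) (ht : 0 ≤ t)
    (h : r ^ 2 + t ^ 2 = 1) (hrt : r * t ≠ 0) (p : Phases M) {z : ℂ} (hz : z ≠ 0) (L : ℕ) :
    ‖(Matrix.scalar (Box L M) z - reflected r t p L).det‖ =
      ‖(boundaryMatrix z (propagator r t p z L)).det‖ *
        (‖z‖ ^ (4 * L * M) * (r * t) ^ (2 * L * M)) := by
  rw [← norm_det_pivoted, Matrix.twoBlockTriangular_det _
    (fun i : Box L M => i.toSite.1 = -(2 * (L : ℤ))), norm_mul]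
  · congr 1
    · let e : Fin (2 * M) ≃ {i : Box L M // i.toSite.1 = -(2 * (L : ℤ))} :=
        { toFun := fun k => ⟨Box.mk (-(2 * (L : ℤ)), k) (by dsimp only; omega), rfl⟩
          invFun := fun i => i.1.toSite.2
          left_inv := fun _ => rfl
          right_inv := fun i => Subtype.ext (Box.toSite_injective (Prod.ext i.2.symm rfl)) }
      rw [← Matrix.det_submatrix_equiv_self e]
      congr 2
      ext k k'
      have hw : IsWall L (pivotRow (e k).1).toSite := (isWall_pivotRow_iff _).mpr (e k).2
      rw [Matrix.submatrix_apply, Matrix.toSquareBlockProp_def, Matrix.of_apply, pivoted,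
        Matrix.submatrix_apply, id, transformed_apply_of_isWall r t p z L hw (e k').2,
        toSite_pivotRow, boundaryMatrix, Matrix.of_apply, propagator_eq h hrt p hz]
      have e1 : (e k).1.toSite = (-(2 * (L : ℤ)), k) := rfl
      have e2 : (e k').1.toSite.2 = k' := rfl
      rw [e1, e2]
      by_cases hk : Even (k : ℕ)
      · simp [hk, columnTransferProd]
      · have : (2 * (L : ℤ) + 2 * (L : ℤ)).toNat = 4 * L := by omega
        simp [hk, this]
    · exact norm_det_pivoted_bulk hr ht p z L
  · intro i hi j hj
    rw [pivoted, Matrix.submatrix_apply]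
    exact transformed_apply_of_not_isWall h hrt p hz L
      (fun hw => hi ((isWall_pivotRow_iff i).mp hw)) hj

/-! ### From the determinant to the lower bound. -/

theorem integral_log_densityOfStates {M : ℕ} [NeZero M] {r t : ℝ} (h : r ^ 2 + t ^ 2 = 1)
    (p : Phases M) (L : ℕ) {z : ℂ} (hz : ‖z‖ ≠ 1) :
    (Matrix.scalar (Box L M) z - reflected r t p L).det ≠ 0 ∧
    ∫ x : Circle, Real.log ‖z - (x : ℂ)‖ ∂(densityOfStates r t p L) =
      ((4 * (L : ℝ) + 1) * (2 * M))⁻¹ *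
        Real.log ‖(Matrix.scalar (Box L M) z - reflected r t p L).det‖ := by
  have hdet : (Matrix.scalar (Box L M) z - reflected r t p L).det =
      ((reflected r t p L).charpoly.roots.map fun x => z - x).prod := by
    rw [← Matrix.eval_charpoly, (IsAlgClosed.splits _).eval_eq_prod_roots_of_monic
      (Matrix.charpoly_monic _)]
  have hne : ∀ x ∈ (reflected r t p L).charpoly.roots, z - x ≠ 0 := by
    intro x hx h0
    rw [sub_eq_zero] at h0
    exact hz (h0 ▸ norm_root_charpoly_reflected r t h p L hx)
  have hlog : ∀ s : Multiset ℂ, (∀ x ∈ s, z - x ≠ 0) → (s.map fun x => z - x).prod ≠ 0 ∧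
      (s.map fun x => Real.log ‖z - x‖).sum = Real.log ‖(s.map fun x => z - x).prod‖ := by
    intro s
    induction s using Multiset.induction with
    | empty => simp
    | cons a s ih =>
      intro hs
      obtain ⟨h1, h2⟩ := ih fun x hx => hs x (Multiset.mem_cons_of_mem hx)
      have h3 := hs a (Multiset.mem_cons_self a s)
      simp only [Multiset.map_cons, Multiset.prod_cons, Multiset.sum_cons, norm_mul]
      refine ⟨mul_ne_zero h3 h1, ?_⟩
      rw [Real.log_mul (norm_ne_zero_iff.mpr h3) (norm_ne_zero_iff.mpr h1), h2]
  obtain ⟨h1, h2⟩ := hlog _ hne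
  rw [hdet]
  refine ⟨h1, ?_⟩
  rw [integral_densityOfStates r t h p L (fun x => Real.log ‖z - x‖), h2, smul_eq_mul]

theorem log_exteriorPowerNorm_propagator_ge {M : ℕ} [NeZero M] {r t : ℝ} (hr : 0 ≤ r)
    (ht : 0 ≤ t) (h : r ^ 2 + t ^ 2 = 1) (hrt : r * t ≠ 0) (p : Phases M) {L : ℕ} (hL : 1 ≤ L)
    {z : ℂ} (hz : z ≠ 0) (hz1 : ‖z‖ ≠ 1) :
    (1 / 2) * Real.log (1 / (r * t))
        + (2 + 1 / (2 * (L : ℝ))) *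
          (∫ x : Circle, Real.log ‖z - (x : ℂ)‖ ∂(densityOfStates r t p L))
        - (1 + 1 / (4 * (L : ℝ))) * Real.log ‖z‖
        - 1 * (1 + |Real.log ‖z‖|) / (L : ℝ)
      ≤ 1 / (4 * (L : ℝ) * (M : ℝ)) *
        Real.log (exteriorPowerNorm M (propagator r t p z L)) := by
  obtain ⟨hdet0, hint⟩ := integral_log_densityOfStates h p L hz1
  have hdet := norm_det_scalar_sub_reflected hr ht h hrt p hz L
  have hle := norm_det_boundaryMatrix_le hz (propagator r t p z L)
  rw [hint]
  have hrt0 : 0 < r * t := lt_of_le_of_ne (mul_nonneg hr ht) hrt.symm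
  have ha : 0 < ‖z‖ := norm_pos_iff.mpr hz
  have hD : 0 < ‖(Matrix.scalar (Box L M) z - reflected r t p L).det‖ := norm_pos_iff.mpr hdet0
  generalize ‖(Matrix.scalar (Box L M) z - reflected r t p L).det‖ = D at *
  have hE0 : 0 ≤ exteriorPowerNorm M (propagator r t p z L) := norm_nonneg _
  generalize exteriorPowerNorm M (propagator r t p z L) = E at *
  generalize ‖(boundaryMatrix z (propagator r t p z L)).det‖ = G at *
  generalize ‖z‖ = a at *
  generalize r * t = b at *
  have hG : 0 < G := by
    have hw : 0 < a ^ (4 * L * M) * b ^ (2 * L * M) := by positivity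
    rw [hdet] at hD
    exact (pos_iff_pos_of_mul_pos hD).mpr hw
  -- Positivity is inherited from the nonvanishing determinant; the logarithm of the norm is thus
  -- not a default value.
  have hE : 0 < E := by
    refine lt_of_le_of_ne hE0 fun h0 => ?_
    rw [← h0] at hle
    simp at hle
    linarith
  have hlogD : Real.log D = Real.log G + (4 * L * M * Real.log a + 2 * L * M * Real.log b) := by
    rw [hdet, Real.log_mul hG.ne' (by positivity), Real.log_mul (by positivity) (by positivity),
      Real.log_pow, Real.log_pow]
    push_cast
    ring
  have hlogG : Real.log G ≤ M * Real.log a + (M * Real.log (1 + a) +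
      (M * Real.log (1 + a⁻¹) + Real.log E)) := by
    refine (Real.log_le_log hG hle).trans (le_of_eq ?_)
    rw [Real.log_mul (by positivity) (by positivity), Real.log_mul (by positivity) (by positivity),
      Real.log_mul (by positivity) (by positivity), Real.log_pow, Real.log_pow, Real.log_pow]
  -- Since $1+x\le 2e^{|\log x|}\le e^{1+|\log x|}$, a factor $2$ would do. With $4$ the error
  -- $4M(1+|\log a|)$, divided by $4LM$, has constant exactly $1$ for every $M$.
  have hside : Real.log (1 + a) + Real.log (1 + a⁻¹) ≤ 4 * (1 + |Real.log a|) := by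
    have hmax : ∀ x : ℝ, 0 < x → Real.log (1 + x) ≤ 1 + |Real.log x| := by
      intro x hx
      rw [Real.log_le_iff_le_exp (by positivity), Real.exp_add]
      have h1 : x ≤ Real.exp |Real.log x| := by
        rw [← Real.log_le_iff_le_exp hx]; exact le_abs_self _
      have h2 : 1 ≤ Real.exp |Real.log x| := Real.one_le_exp (abs_nonneg _)
      have h3 := Real.add_one_le_exp 1
      nlinarith
    have h1 := hmax a ha
    have h2 := hmax a⁻¹ (by positivity)
    rw [Real.log_inv, abs_neg] at h2
    have := abs_nonneg (Real.log a)
    linarith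
  have hM : (0 : ℝ) < M := by exact_mod_cast Nat.pos_of_ne_zero (NeZero.ne M)
  have hL' : (0 : ℝ) < L := by exact_mod_cast hL
  have hfinal : Real.log D - 4 * L * M * Real.log a - 2 * L * M * Real.log b - M * Real.log a -
      M * (4 * (1 + |Real.log a|)) ≤ Real.log E := by
    have := mul_le_mul_of_nonneg_left hside hM.le
    linarith
  have hcoef : 0 ≤ 1 / (4 * (L : ℝ) * M) := by positivity
  refine le_trans (le_of_eq ?_) (mul_le_mul_of_nonneg_left hfinal hcoef)
  rw [one_div b, Real.log_inv]
  field_simp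
  ring

end ChalkerCoddington

theorem mainTheorem6 (M : ℕ) [NeZero M] :
    (∀ r t : ℝ, r ∈ Set.Icc (0 : ℝ) 1 → t ∈ Set.Icc (0 : ℝ) 1 → r ^ 2 + t ^ 2 = 1 → r * t ≠ 0 →
      (∀ (p : ChalkerCoddington.Phases M) (L : ℕ),
        MeasureTheory.IsProbabilityMeasure (ChalkerCoddington.densityOfStates r t p L) ∧
        ∀ f : ℂ → ℂ, ContinuousOn f (Metric.sphere (0 : ℂ) 1) →
          (1 / ((4 * (L : ℂ) + 1) * (2 * (M : ℂ)))) *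
              (cfc f (ChalkerCoddington.reflected r t p L)).trace =
            ∫ x : Circle, f (x : ℂ) ∂(ChalkerCoddington.densityOfStates r t p L)) ∧
      (∀ᵐ p ∂(ChalkerCoddington.phaseLaw M), ∀ f : C(Circle, ℂ),
        Filter.Tendsto (fun L : ℕ => ∫ x, f x ∂(ChalkerCoddington.densityOfStates r t p L))
          Filter.atTop (nhds (∫ x, f x ∂ChalkerCoddington.dl)))) ∧
    (∃ c : ℝ, 0 < c ∧
      ∀ r t : ℝ, r ∈ Set.Icc (0 : ℝ) 1 → t ∈ Set.Icc (0 : ℝ) 1 → r ^ 2 + t ^ 2 = 1 → r * t ≠ 0 →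
      ∀ (p : ChalkerCoddington.Phases M) (L : ℕ), 1 ≤ L → ∀ z : ℂ, z ≠ 0 → ‖z‖ ≠ 1 →
        (1 / 2) * Real.log (1 / (r * t))
            + (2 + 1 / (2 * (L : ℝ))) *
              (∫ x : Circle, Real.log ‖z - (x : ℂ)‖ ∂(ChalkerCoddington.densityOfStates r t p L))
            - (1 + 1 / (4 * (L : ℝ))) * Real.log ‖z‖
            - c * (1 + |Real.log ‖z‖|) / (L : ℝ)
          ≤ 1 / (4 * (L : ℝ) * (M : ℝ)) *
            Real.log (ChalkerCoddington.exteriorPowerNorm M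
              (ChalkerCoddington.propagator r t p z L))) := by
  refine ⟨fun r t _ _ h _ => ⟨fun p L =>
    ⟨ChalkerCoddington.isProbabilityMeasure_densityOfStates r t h p L,
      fun f _ => ChalkerCoddington.trace_cfc_reflected r t h p L f⟩,
    ChalkerCoddington.ae_tendsto_integral_densityOfStates h⟩, 1, one_pos, ?_⟩
  intro r t hr ht h hrt p L hL z hz hz1
  exact ChalkerCoddington.log_exteriorPowerNorm_propagator_ge hr.1 ht.1 h hrt p hL hz hz1
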